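/- **Setting.** Let $n\ge 1$, $X\in\mathbb R^{n\times p}$ be a fixed design matrix, and $y=X\beta^*+w$ with $w\sim\mathcal N(0,\sigma^2 I_n)$, $\sigma\ge 0$, where all components of $\beta^*\in\mathbb R^p$ are non-negative. Let $S=\{j:\beta^*_j\ne 0\}$, $s=|S|$, and let $$S_1=\Big\{j\in S:|\beta^*_j|\ge 2\sigma\log p\,\sqrt{\tfrac{\log p}{n}}\Big\},\qquad S_2=\Big\{j\in S:|\beta^*_j|\le 2\sigma\sqrt{\tfrac{\log p}{n}}\Big\}$$ be the sets of strong and weak signals, $s_1=|S_1|\ge 1$, $s_2=|S_2|$. Let $m$ be the $s_1$-th largest value among the $|\beta^*_j|$, and $\kappa=\max_j|\beta^*_j|/m$. The matrix $X$ is $(k,\delta)$-RIP if $(1-\delta)\|u\|^2\le \frac1n\|Xu\|^2\le(1+\delta)\|u\|^2$ for every $u\in\mathbb R^p$ with at most $k$ nonzero components. Gradient descent with step size $\eta$ on $f(u)=\frac1{2n}\|X(u\circ u)-y\|^2$, started at $u_0=\alpha\mathbf 1$, is $$u_{t+1}=u_t-2\eta\,u_t\circ\big[n^{-1}X^T(X(u_t\circ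 u_t)-y)\big],\qquad t=0,1,2,\dots$$ **Theorem.** For every constant $C_0>0$ there are constants $c_1,\dots,c_6>0$, depending only on $C_0$, such that the following holds for all $n,p,X,\beta^*,\sigma,\alpha,\eta,\delta$ as above and all $M\ge 1$. Assume * (A) $s=s_1+s_2$ and $\kappa m\le C_0$; * (B) $X$ is $(s+1,\delta)$-RIP with $\delta\le c_3/(\kappa\sqrt s\,\log\frac p\alpha)$; * (C) $0<\alpha\le c_3/p$ and $0<\eta\le c_3/(\kappa\log\frac p\alpha)$. Put $\epsilon=\max\{\alpha^2,\ \sigma^2\frac{Ms_1}{n},\ \sigma^2\frac{s_2\log p}{n}\}$ and $\tau=\max\{\delta\alpha,\ \sigma\sqrt{\frac{\log p}{n}}\}$. Then for every integer $t\ge 0$ with $$\frac{c_1\log(p/\alpha)}{\eta m}\le t\le\frac{c_2}{\eta\tau}$$ (there is no upper restriction if $\tau=0$), with probability at least $1-p^{-c_4}-e^{-c_5Ms}$, $$\|u_t\circ u_t-\beta^*\|^2\le c_6\,\epsilon .$$ In particular, when all signals are strong ($s_2=0$), the bound is $c_6\max\{\alpha^2,\sigma^2Ms_1/n\}$. -/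

import Mathlib

open scoped Matrix
open MeasureTheory ProbabilityTheory

noncomputable section

namespace HadamardGD

/-- The support `S = {j : β j ≠ 0}` of a vector. -/
def supp {p : ℕ} (β : Fin p → ℝ) : Finset (Fin p) :=
  Finset.univ.filter fun j => β j ≠ 0

/-- The squared Euclidean norm. -/
def sqNorm {k : ℕ} (v : Fin k → ℝ) : ℝ := ∑ i, v i ^ 2

/-- Indices of the strong signals: nonzero components of absolute value at least
`2 σ log p √(log p / n)`. -/
def strongSet (n : ℕ) {p : ℕ} (σ : ℝ) (β : Fin p → ℝ) : Finset (Fin p) :=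
  (supp β).filter fun j => 2 * σ * Real.log p * √(Real.log p / n) ≤ |β j|

/-- Indices of the weak signals: nonzero components of absolute value at most
`2 σ √(log p / n)`. -/
def weakSet (n : ℕ) {p : ℕ} (σ : ℝ) (β : Fin p → ℝ) : Finset (Fin p) :=
  (supp β).filter fun j => |β j| ≤ 2 * σ * √(Real.log p / n)

/-- `θ_k(β)`, the `k`-th largest absolute component value (`1 ≤ k ≤ p`): the largest `r` such that
at least `k` components have absolute value at least `r`. -/
def kthLargestAbs {p : ℕ} (β : Fin p → ℝ) (k : ℕ) : ℝ :=
  sSup {r : ℝ | k ≤ (Finset.univ.filter fun j => r ≤ |β j|).card}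

/-- `m = θ_{s₁}(β)`, the minimal strength of the strong signals, `s₁` being their number. -/
def minStrength (n : ℕ) {p : ℕ} (σ : ℝ) (β : Fin p → ℝ) : ℝ :=
  kthLargestAbs β (strongSet n σ β).card

/-- `κ`, the ratio of the largest absolute signal value to the smallest strong signal. -/
def condNumber (n : ℕ) {p : ℕ} (σ : ℝ) (β : Fin p → ℝ) : ℝ :=
  (⨆ j, |β j|) / minStrength n σ β

/-- The `(k, δ)`-restricted isometry property of `X`, with the normalization `1 / n`. -/
def RIP {n p : ℕ} (X : Matrix (Fin n) (Fin p) ℝ) (k : ℕ) (δ : ℝ) : Prop :=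
  ∀ u : Fin p → ℝ, (supp u).card ≤ k →
    (1 - δ) * sqNorm u ≤ (1 / (n : ℝ)) * sqNorm (X *ᵥ u) ∧
      (1 / (n : ℝ)) * sqNorm (X *ᵥ u) ≤ (1 + δ) * sqNorm u

/-- The loss `f(u) = (2n)⁻¹ ‖X (u ∘ u) - y‖²`. -/
def loss {n p : ℕ} (X : Matrix (Fin n) (Fin p) ℝ) (y : Fin n → ℝ) (u : Fin p → ℝ) : ℝ :=
  (1 / (2 * (n : ℝ))) * sqNorm (X *ᵥ (u ^ 2) - y)

/-- The gradient of the loss, `∇f(u) = 2 u ∘ [n⁻¹ Xᵀ (X (u ∘ u) - y)]`. -/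
def lossGrad {n p : ℕ} (X : Matrix (Fin n) (Fin p) ℝ) (y : Fin n → ℝ) (u : Fin p → ℝ) :
    Fin p → ℝ :=
  (2 : ℝ) • (u * ((1 / (n : ℝ)) • (Xᵀ *ᵥ (X *ᵥ (u ^ 2) - y))))

/-- `lossGrad` consists of the partial derivatives of `loss`. -/
theorem hasDerivAt_loss {n p : ℕ} (X : Matrix (Fin n) (Fin p) ℝ) (y : Fin n → ℝ)
    (u : Fin p → ℝ) (j : Fin p) :
    HasDerivAt (fun x : ℝ => loss X y (Function.update u j x)) (lossGrad X y u j) (u j) := by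
  have h1 : ∀ i : Fin n, HasDerivAt
      (fun x : ℝ => (X *ᵥ (Function.update u j x ^ 2) - y) i) (X i j * (2 * u j)) (u j) := by
    intro i
    have h2 : ∀ k : Fin p, HasDerivAt (fun x : ℝ => X i k * (Function.update u j x k) ^ 2)
        (if k = j then X i j * (2 * u j) else 0) (u j) := by
      intro k
      by_cases hk : k = j
      · subst hk
        simpa using (hasDerivAt_pow 2 (u k)).const_mul (X i k)
      · simpa [hk] using hasDerivAt_const (u j) (X i k * u k ^ 2)
    have h3 := (HasDerivAt.fun_sum (u := Finset.univ) fun k _ => h2 k).sub_const (y i)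
    simpa [Matrix.mulVec, dotProduct] using h3
  have h4 := (HasDerivAt.fun_sum (u := Finset.univ) fun i _ => (h1 i).fun_pow 2).const_mul
    (1 / (2 * (n : ℝ)))
  refine h4.congr_deriv ?_
  simp only [lossGrad, Function.update_eq_self, Pi.smul_apply, Pi.mul_apply, smul_eq_mul,
    Matrix.mulVec, dotProduct, Matrix.transpose_apply, Finset.mul_sum]
  refine Finset.sum_congr rfl fun i _ => ?_
  simp only [Matrix.mulVec, dotProduct, Pi.sub_apply]
  ring

/-- Gradient descent with step size `η` on `loss X y`, started at `u₀ = α • 1`. -/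
def gdIter {n p : ℕ} (X : Matrix (Fin n) (Fin p) ℝ) (y : Fin n → ℝ) (η α : ℝ) :
    ℕ → Fin p → ℝ
  | 0 => fun _ => α
  | t + 1 => gdIter X y η α t - η • lossGrad X y (gdIter X y η α t)

/-- The law `N(0, σ² I)` on `ℝⁿ`. -/
def gaussianNoise (n : ℕ) (σ : ℝ) : Measure (Fin n → ℝ) :=
  Measure.pi fun _ => gaussianReal 0 (σ ^ 2).toNNReal

/-- The statistical error `ε = max {α², σ² M s₁ / n, σ² s₂ log p / n}`. -/
def epsilonRate (n p : ℕ) (σ α M : ℝ) (s₁ s₂ : ℕ) : ℝ :=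
  max (α ^ 2) (max (σ ^ 2 * (M * s₁ / n)) (σ ^ 2 * (s₂ * Real.log p / n)))

/-- `τ = max {δ α, σ √(log p / n)}`. -/
def tauRate (n p : ℕ) (σ α δ : ℝ) : ℝ :=
  max (δ * α) (σ * √(Real.log p / n))

end HadamardGD

end

/-! ### One step of the squared iteration in a single coordinate, and elementary sums. -/

namespace HadamardGD

/-! Put `v = u ∘ u`. Gradient descent becomes, in each coordinate, `v ↦ v (1 - 2η(v - β + b))²`, and
the coordinates interact only through `b = (n⁻¹XᵀX - I)(v - β) - ν` with `ν = n⁻¹Xᵀw`. While `|b| ≤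
m / 4`, a strong coordinate grows from `α²` by a factor of at least `1 + ηm` until it passes `β / 2`
(`min_le_step`), and its new error is at most a convex combination of the old error and `|b|`
(`abs_step_sub_le`). Every other coordinate grows by a factor of at most `exp (4η(β + |b|))`
(`step_le_mul_exp`). It therefore stays below `4α²` until the accumulated drift reaches a constant,
which is why the time is capped at order `1 / (ητ)`.

RIP bounds `b` in coordinate `j` by `|ν j|` plus `δ` times the sum of the ℓ₂ error on the strong
set, the ℓ₂ norm `W` of the remaining signal, and the ℓ₁ mass of `v` off the strong set
(`RIP.abs_gramDev_sub_le`). The growth bounds need `b` small and the bound on `b` needs the growth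
bounds, so both are carried by one induction in time (`Regime.invariants`). The strong error is kept
as `|ν j|` plus a common floor plus a decaying transient. Keeping `|ν j|` per coordinate makes the
final squared error (`Regime.sum_sq_le`) depend on the sum of `ν j ^ 2` over strong `j`; this yields
`M s₁` in place of `s₁ log p`. Weak signals are not recovered: their own energy is charged to `W ^
2`.

Randomness enters only through `ν`, via its maximum (Chernoff and a union bound) and its energy on
the strong set (Gaussian decoupling, `lintegral_exp_noiseCorr_le`). On the event where both are
small, the argument is deterministic. -/

theorem abs_step_sub_le {η v β b : ℝ} (hη : 0 < η) (hv : 0 ≤ v)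
    (h : |η * (v - β + b)| ≤ 1 / 2) (hv1 : 6 * (η * v) ≤ 1) :
    ∃ θ, 2 * (η * v) ≤ θ ∧ θ ≤ 1 ∧
      |v * (1 - 2 * η * (v - β + b)) ^ 2 - β| ≤ (1 - θ) * |v - β| + θ * |b| := by
  obtain ⟨h1, h2⟩ := abs_le.1 h
  have hηv : 0 ≤ η * v := by positivity
  -- Expanding the square gives exactly `(1 - θ)(v - β) - θ b` for this `θ`. The hypotheses put `1 -
  -- η(v - β + b)` between `1/2` and `3/2`, hence the two bounds on `θ`.
  refine ⟨4 * (η * v) * (1 - η * (v - β + b)), by nlinarith, by nlinarith, ?_⟩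
  set θ := 4 * (η * v) * (1 - η * (v - β + b)) with hθ
  have h0 : 0 ≤ θ := by nlinarith
  have h3 : θ ≤ 1 := by nlinarith
  have e : v * (1 - 2 * η * (v - β + b)) ^ 2 - β = (1 - θ) * (v - β) + -(θ * b) := by
    rw [hθ]; ring
  rw [e]
  refine (abs_add_le _ _).trans ?_
  rw [abs_neg, abs_mul, abs_mul, abs_of_nonneg h0, abs_of_nonneg (sub_nonneg.2 h3)]

/-- Below `β / 2` the residual `v - β + b` is at most `-m / 4`, which forces growth by `1 + ηm`.
Above `β / 2` a decreasing step is too short to fall back under it. -/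
theorem min_le_step {η v β b m a : ℝ} (hη : 0 < η) (hm : 0 < m) (hβ : m ≤ β) (hv : 0 ≤ v)
    (hb : |b| ≤ m / 4) (hv1 : 6 * (η * v) ≤ 1) (ha : min (β / 2) a ≤ v) :
    min (β / 2) (a * (1 + η * m)) ≤ v * (1 - 2 * η * (v - β + b)) ^ 2 := by
  obtain ⟨h1, h2⟩ := abs_le.1 hb
  have hηv : 0 ≤ η * v := by positivity
  rcases le_or_gt (β / 2) v with h | h
  · refine (min_le_left _ _).trans ?_
    rcases le_or_gt (v - β + b) 0 with hx | hx
    · have h3 : 0 ≤ η * -(v - β + b) := mul_nonneg hη.le (neg_nonneg.2 hx)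
      have : 1 ≤ (1 - 2 * η * (v - β + b)) ^ 2 := by
        nlinarith [sq_nonneg (η * (v - β + b))]
      nlinarith
    · have : v - 4 * (η * v) * (v - β + b) ≤ v * (1 - 2 * η * (v - β + b)) ^ 2 := by
        have : 0 ≤ v * (2 * η * (v - β + b)) ^ 2 := by positivity
        nlinarith
      nlinarith
  · have ha' : a ≤ v := by
      rcases min_le_iff.1 ha with h' | h'
      · linarith
      · exact h'
    refine (min_le_right _ _).trans ?_
    have hx : v - β + b ≤ -(m / 4) := by linarith
    have h3 : 1 + η * m ≤ (1 - 2 * η * (v - β + b)) ^ 2 := by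
      have : 0 ≤ (2 * η * (v - β + b)) ^ 2 := by positivity
      nlinarith
    have h4 : 0 ≤ 1 + η * m := by positivity
    nlinarith

theorem step_le_mul_exp {η v β b : ℝ} (hη : 0 < η) (hv : 0 ≤ v) (hβ : 0 ≤ β)
    (hv1 : 6 * (η * v) ≤ 1) :
    v * (1 - 2 * η * (v - β + b)) ^ 2 ≤ v * Real.exp (4 * (η * (β + |b|))) := by
  refine mul_le_mul_of_nonneg_left ?_ hv
  have hηv : 0 ≤ η * v := by positivity
  have h1 := neg_abs_le b
  have h2 := le_abs_self b
  have h3 : |1 - 2 * η * (v - β + b)| ≤ 1 + 2 * (η * (β + |b|)) := by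
    rw [abs_le]; constructor <;> nlinarith
  have h4 : |1 - 2 * η * (v - β + b)| ≤ Real.exp (2 * (η * (β + |b|))) := by
    linarith [Real.add_one_le_exp (2 * (η * (β + |b|)))]
  calc (1 - 2 * η * (v - β + b)) ^ 2 = |1 - 2 * η * (v - β + b)| ^ 2 := (sq_abs _).symm
    _ ≤ Real.exp (2 * (η * (β + |b|))) ^ 2 := by gcongr
    _ = _ := by rw [← Real.exp_nat_mul]; congr 1; push_cast; ring

theorem sqrt_sum_sq_le_of_abs_le {ι : Type*} (S : Finset ι) {d ν : ι → ℝ} {g k : ℝ} (hg : 0 ≤ g)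
    (hk : (S.card : ℝ) ≤ k) (h : ∀ j ∈ S, |d j| ≤ |ν j| + g) :
    √(∑ j ∈ S, d j ^ 2) ≤ √(∑ j ∈ S, ν j ^ 2) + √k * g := by
  have hk0 : 0 ≤ k := le_trans (by positivity) hk
  refine Real.sqrt_le_iff.2 ⟨by positivity, ?_⟩
  have h1 : ∑ j ∈ S, d j ^ 2 ≤ ∑ j ∈ S, (ν j ^ 2 + 2 * g * |ν j| + g ^ 2) := by
    refine Finset.sum_le_sum fun j hj => ?_
    rw [← sq_abs (d j), ← sq_abs (ν j)]
    nlinarith [h j hj, abs_nonneg (d j), abs_nonneg (ν j)]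
  have h2 : ∑ j ∈ S, |ν j| ≤ √k * √(∑ j ∈ S, ν j ^ 2) := by
    rw [← Real.sqrt_mul hk0]
    refine Real.le_sqrt_of_sq_le ?_
    refine sq_sum_le_card_mul_sum_sq.trans ?_
    simp only [sq_abs]
    gcongr
  have h0 : 0 ≤ ∑ j ∈ S, ν j ^ 2 := by positivity
  have h3 : √(∑ j ∈ S, ν j ^ 2) ^ 2 = ∑ j ∈ S, ν j ^ 2 := Real.sq_sqrt h0
  have h4 : √k ^ 2 = k := Real.sq_sqrt hk0
  rw [Finset.sum_add_distrib, Finset.sum_add_distrib, ← Finset.mul_sum, Finset.sum_const,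
    nsmul_eq_mul] at h1
  have h5 : (S.card : ℝ) * g ^ 2 ≤ k * g ^ 2 := by gcongr
  have h6 : 2 * g * ∑ j ∈ S, |ν j| ≤ 2 * g * (√k * √(∑ j ∈ S, ν j ^ 2)) := by gcongr
  calc _ ≤ _ := h1
    _ ≤ (∑ j ∈ S, ν j ^ 2) + 2 * g * (√k * √(∑ j ∈ S, ν j ^ 2)) + k * g ^ 2 := by gcongr
    _ = _ := by rw [← h3, ← h4]; simp only [Real.sqrt_sq (Real.sqrt_nonneg _)]; ring

theorem sum_pow_sub_le_self {ρ : ℝ} (h0 : 0 ≤ ρ) (h1 : ρ ≤ 1) (T₀ t : ℕ) :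
    ∑ i ∈ Finset.range t, ρ ^ (i - T₀) ≤ t := by
  calc _ ≤ ∑ i ∈ Finset.range t, (1 : ℝ) := Finset.sum_le_sum fun i _ => pow_le_one₀ h0 h1
    _ = t := by simp

/-- Truncated subtraction makes the sequence a plateau of `T₀` ones followed by a geometric tail. -/
theorem sum_pow_sub_le {ρ : ℝ} (h0 : 0 ≤ ρ) (h1 : ρ < 1) (T₀ t : ℕ) :
    ∑ i ∈ Finset.range t, ρ ^ (i - T₀) ≤ T₀ + 1 / (1 - ρ) := by
  have hρ : 0 < 1 - ρ := sub_pos.2 h1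
  rcases le_total t T₀ with h | h
  · refine (sum_pow_sub_le_self h0 h1.le T₀ t).trans ?_
    have : (t : ℝ) ≤ T₀ := by exact_mod_cast h
    have : 0 ≤ 1 / (1 - ρ) := by positivity
    linarith
  · obtain ⟨k, rfl⟩ := Nat.exists_eq_add_of_le h
    rw [Finset.sum_range_add]
    refine add_le_add (sum_pow_sub_le_self h0 h1.le T₀ T₀) ?_
    simp only [Nat.add_sub_cancel_left]
    rw [geom_sum_eq h1.ne, ← neg_div_neg_eq, neg_sub, neg_sub]
    gcongr
    linarith [pow_nonneg h0 k]

end HadamardGD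

/-! ### Deterministic dynamics: scales, perturbation bounds and the drift budget. -/

namespace HadamardGD

/-- A perturbed multiplicative iteration `v` with strong coordinates `S`, together with the
relations between signal strength, step size, initialization and horizon `T`. -/
structure Regime {p : ℕ} (S : Finset (Fin p)) (β ν : Fin p → ℝ) (v b : ℕ → Fin p → ℝ)
    (c C η α δ m κ k lam τ W : ℝ) (T : ℕ) : Prop where
  c_pos : 0 < c
  c_le : c ≤ 1 / 72
  C_pos : 0 < C
  cC_le : c * C ≤ 1 / 72
  η_pos : 0 < η
  α_pos : 0 < α
  δ_nonneg : 0 ≤ δ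
  m_pos : 0 < m
  one_le_κ : 1 ≤ κ
  one_le_L : 1 ≤ Real.log (p / α)
  κm_le : κ * m ≤ C
  one_le_k : 1 ≤ k
  card_le : (S.card : ℝ) ≤ k
  k_le : k ≤ p
  δ_le : δ * (κ * √k * Real.log (p / α)) ≤ c
  η_le : η * (κ * Real.log (p / α)) ≤ c
  α_le : p * α ≤ c
  δα_le : δ * α ≤ τ
  lam_nonneg : 0 ≤ lam
  lam_le : lam ≤ τ
  horizon_le : T * (η * τ) ≤ 1 / 100
  le_horizon : 13 * Real.log (p / α) / (η * m) ≤ T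
  β_nonneg : ∀ j, 0 ≤ β j
  le_β : ∀ j ∈ S, m ≤ β j
  β_le : ∀ j, β j ≤ κ * m
  β_weak : ∀ j ∉ S, β j ≤ 2 * lam
  W_nonneg : 0 ≤ W
  W_le : W ≤ 2 * √k * lam
  sum_β_le : ∑ j ∈ Sᶜ, β j ^ 2 ≤ W ^ 2
  ν_le : ∀ j, |ν j| ≤ 4 * lam
  v_zero : ∀ j, v 0 j = α ^ 2
  v_succ : ∀ t j, v (t + 1) j = v t j * (1 - 2 * η * (v t j - β j + b t j)) ^ 2
  b_le : ∀ t j, |b t j| ≤ |ν j| + δ * (√(∑ i ∈ S, (v t i - β i) ^ 2) + W + ∑ i ∈ Sᶜ, v t i)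

namespace Regime

variable {p : ℕ} {S : Finset (Fin p)} {β ν : Fin p → ℝ} {v b : ℕ → Fin p → ℝ}
  {c C η α δ m κ k lam τ W : ℝ} {T : ℕ}

theorem v_nonneg (h : Regime S β ν v b c C η α δ m κ k lam τ W T) (t : ℕ) (j : Fin p) :
    0 ≤ v t j := by
  cases t with
  | zero => rw [h.v_zero]; positivity
  | succ t =>
    have := v_nonneg h t j
    rw [h.v_succ]; positivity

theorem τ_nonneg (h : Regime S β ν v b c C η α δ m κ k lam τ W T) : 0 ≤ τ :=
  h.lam_nonneg.trans h.lam_le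

theorem sqrt_k_ge (h : Regime S β ν v b c C η α δ m κ k lam τ W T) : 1 ≤ √k :=
  Real.one_le_sqrt.2 h.one_le_k

theorem δ_sqrt_mul_le (h : Regime S β ν v b c C η α δ m κ k lam τ W T) :
    δ * √k * (κ * m) ≤ c * m / Real.log (p / α) := by
  have := h.m_pos
  rw [le_div_iff₀ (by linarith [h.one_le_L])]
  calc _ = δ * (κ * √k * Real.log (p / α)) * m := by ring
    _ ≤ _ := mul_le_mul_of_nonneg_right h.δ_le h.m_pos.le

theorem δ_sqrt_le (h : Regime S β ν v b c C η α δ m κ k lam τ W T) : δ * √k ≤ c := by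
  have h1 := h.sqrt_k_ge
  have h2 := h.δ_nonneg
  refine le_trans ?_ h.δ_le
  have : 1 ≤ κ * Real.log (p / α) := one_le_mul_of_one_le_of_one_le h.one_le_κ h.one_le_L
  have h3 : 0 ≤ δ * √k := by positivity
  nlinarith

/-- The time window is nonempty: `le_horizon` and `horizon_le` together force `13 τ log (p / α) ≤ m
/ 100`. The perturbation level is thus far below every strong signal. -/
theorem τ_le (h : Regime S β ν v b c C η α δ m κ k lam τ W T) : τ ≤ m / 1300 := by
  have h1 := h.le_horizon
  have h2 := h.horizon_le
  have h3 := h.η_pos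
  have h4 := h.m_pos
  have h5 := h.τ_nonneg
  rw [div_le_iff₀ (by positivity)] at h1
  have h6 : 13 * τ ≤ 13 * Real.log (p / α) * τ := by nlinarith [h.one_le_L]
  have h7 : 13 * Real.log (p / α) * τ ≤ (T * (η * τ)) * m := by
    calc _ ≤ T * (η * m) * τ := by gcongr
      _ = _ := by ring
  nlinarith

theorem η_κm_le (h : Regime S β ν v b c C η α δ m κ k lam τ W T) : η * (κ * m) ≤ 1 / 72 := by
  have h1 := h.η_pos
  have h3 : 1 ≤ κ := h.one_le_κ
  have h4 := h.m_pos
  have h2 : η * κ ≤ c := by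
    refine le_trans ?_ h.η_le
    have h0 : 0 < η * κ := by positivity
    nlinarith [h.one_le_L]
  have h5 : m ≤ C := by nlinarith [h.κm_le]
  have := h.c_pos
  calc _ = η * κ * m := by ring
    _ ≤ c * C := by gcongr
    _ ≤ _ := h.cC_le

theorem ηm_le (h : Regime S β ν v b c C η α δ m κ k lam τ W T) : η * m ≤ 1 / 72 := by
  have h1 := h.η_pos
  refine le_trans ?_ h.η_κm_le
  have := h.m_pos
  gcongr
  nlinarith [h.one_le_κ]

theorem one_le_p (h : Regime S β ν v b c C η α δ m κ k lam τ W T) : (1 : ℝ) ≤ p :=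
  h.one_le_k.trans h.k_le

theorem α_le_c (h : Regime S β ν v b c C η α δ m κ k lam τ W T) : α ≤ c := by
  refine le_trans ?_ h.α_le
  nlinarith [h.one_le_p, h.α_pos]

theorem sqrt_k_le (h : Regime S β ν v b c C η α δ m κ k lam τ W T) : √k ≤ p := by
  rw [Real.sqrt_le_iff]
  exact ⟨by positivity, by nlinarith [h.one_le_p, h.k_le]⟩

theorem η_α_sq_le (h : Regime S β ν v b c C η α δ m κ k lam τ W T) : η * α ^ 2 ≤ 1 / 72 := by
  have h1 := h.η_pos
  have h2 : η ≤ c := by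
    refine le_trans ?_ h.η_le
    nlinarith [one_le_mul_of_one_le_of_one_le h.one_le_κ h.one_le_L]
  have h3 : α ≤ 1 := by linarith [h.α_le_c, h.c_le]
  have h4 : α ^ 2 ≤ 1 := pow_le_one₀ h.α_pos.le h3
  have := h.c_le
  nlinarith [sq_nonneg α]

/-- The `ℓ₂` norm of the noise on the strong coordinates. -/
noncomputable def noise (S : Finset (Fin p)) (ν : Fin p → ℝ) : ℝ := √(∑ j ∈ S, ν j ^ 2)

/-- The stationary part of the error shared by all the strong coordinates. -/
noncomputable def floor (S : Finset (Fin p)) (ν : Fin p → ℝ) (α δ W : ℝ) : ℝ :=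
  2 * δ * (noise S ν + W + α)

/-- The length of the growth phase. -/
noncomputable def burnIn (p : ℕ) (η α m : ℝ) : ℕ := ⌈6 * Real.log (p / α) / (η * m)⌉₊

/-- The transient part of the error. -/
noncomputable def decay (p : ℕ) (η α m : ℝ) (t : ℕ) : ℝ := (1 - η * m / 2) ^ (t - burnIn p η α m)

theorem decay_nonneg (h : Regime S β ν v b c C η α δ m κ k lam τ W T) (t : ℕ) :
    0 ≤ decay p η α m t := pow_nonneg (by linarith [h.ηm_le]) _

theorem decay_le_one (h : Regime S β ν v b c C η α δ m κ k lam τ W T) (t : ℕ) :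
    decay p η α m t ≤ 1 := by
  have := mul_pos h.η_pos h.m_pos
  exact pow_le_one₀ (by linarith [h.ηm_le]) (by linarith)

theorem noise_le (h : Regime S β ν v b c C η α δ m κ k lam τ W T) :
    noise S ν ≤ 4 * √k * lam := by
  have := sqrt_sum_sq_le_of_abs_le S (d := ν) (ν := fun _ => 0) (g := 4 * lam)
    (by linarith [h.lam_nonneg]) h.card_le (fun j _ => by simpa using h.ν_le j)
  simp only [ne_eq, OfNat.ofNat_ne_zero, not_false_eq_true, zero_pow, Finset.sum_const_zero,
    Real.sqrt_zero, zero_add] at this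
  unfold noise; linarith

theorem noise_nonneg : 0 ≤ noise S ν := Real.sqrt_nonneg _

theorem floor_nonneg (h : Regime S β ν v b c C η α δ m κ k lam τ W T) :
    0 ≤ floor S ν α δ W := by
  have := h.δ_nonneg
  have := h.W_nonneg
  have := h.α_pos
  have := noise_nonneg (S := S) (ν := ν)
  unfold floor; positivity

theorem δ_sqrt_lam_le (h : Regime S β ν v b c C η α δ m κ k lam τ W T) :
    δ * √k * lam ≤ τ / 72 := by
  calc _ ≤ (1 / 72) * τ := by
        gcongr
        · exact h.lam_nonneg
        · exact h.δ_sqrt_le.trans h.c_le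
        · exact h.lam_le
    _ = _ := by ring

theorem floor_le (h : Regime S β ν v b c C η α δ m κ k lam τ W T) :
    floor S ν α δ W ≤ 3 * τ := by
  have h1 := h.δ_sqrt_lam_le
  have h2 := mul_le_mul_of_nonneg_left h.noise_le h.δ_nonneg
  have h3 := mul_le_mul_of_nonneg_left h.W_le h.δ_nonneg
  have h4 := h.δα_le
  have h5 := h.τ_nonneg
  unfold floor; nlinarith

theorem sum_weak_le (h : Regime S β ν v b c C η α δ m κ k lam τ W T) {t : ℕ}
    (hw : ∀ j ∉ S, v t j ≤ 4 * α ^ 2) : ∑ j ∈ Sᶜ, v t j ≤ α := by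
  calc _ ≤ ∑ j ∈ Sᶜ, 4 * α ^ 2 := Finset.sum_le_sum fun j hj => hw j (Finset.mem_compl.1 hj)
    _ ≤ ∑ j : Fin p, 4 * α ^ 2 :=
        Finset.sum_le_sum_of_subset_of_nonneg (Finset.subset_univ _) fun _ _ _ => by positivity
    _ = 4 * (p * α) * α := by simp; ring
    _ ≤ 1 * α := by
        have := h.α_pos
        gcongr
        linarith [h.α_le, h.c_le]
    _ = α := one_mul α

/-- Inserting the strong error into `b_le`, the terms in noise, `W` and `α` add up to exactly half
of `floor`; the other half is room for feedback of size `δ √k`. -/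
theorem abs_b_le (h : Regime S β ν v b c C η α δ m κ k lam τ W T) {t : ℕ}
    (hs : ∀ j ∈ S, |v t j - β j| ≤
      |ν j| + (floor S ν α δ W + (κ * m + α ^ 2) * decay p η α m t))
    (hw : ∀ j ∉ S, v t j ≤ 4 * α ^ 2) (j : Fin p) :
    |b t j| ≤ |ν j| + floor S ν α δ W / 2 +
      δ * √k * (floor S ν α δ W + (κ * m + α ^ 2) * decay p η α m t) := by
  have h0 : 0 ≤ κ * m := by have := h.m_pos; have := h.one_le_κ; positivity
  have h1 := sqrt_sum_sq_le_of_abs_le S (d := fun j => v t j - β j) (k := k) (by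
    have := h.floor_nonneg; have := h.decay_nonneg t; positivity) h.card_le hs
  have h2 := h.sum_weak_le hw
  refine (h.b_le t j).trans ?_
  have := mul_le_mul_of_nonneg_left (add_le_add (add_le_add_left h1 W) h2) h.δ_nonneg
  refine (add_le_add_right this _).trans (le_of_eq ?_)
  conv_rhs => rw [floor]
  conv_lhs => rw [floor]
  unfold noise; ring

/-- The self-consistency of the induction: strong errors with floor `F` and transient `G` produce a
perturbation with the same floor and only `G / 2`. -/
theorem abs_b_le_half (h : Regime S β ν v b c C η α δ m κ k lam τ W T) {t : ℕ}
    (hs : ∀ j ∈ S, |v t j - β j| ≤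
      |ν j| + (floor S ν α δ W + (κ * m + α ^ 2) * decay p η α m t))
    (hw : ∀ j ∉ S, v t j ≤ 4 * α ^ 2) (j : Fin p) :
    |b t j| ≤ |ν j| + floor S ν α δ W + (κ * m + α ^ 2) * decay p η α m t / 2 := by
  refine (h.abs_b_le hs hw j).trans ?_
  have h0 : 0 ≤ κ * m := by have := h.m_pos; have := h.one_le_κ; positivity
  have h1 : 0 ≤ floor S ν α δ W + (κ * m + α ^ 2) * decay p η α m t := by
    have := h.floor_nonneg; have := h.decay_nonneg t; positivity
  have h2 : δ * √k ≤ 1 / 2 := by linarith [h.δ_sqrt_le, h.c_le]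
  linarith [mul_le_mul_of_nonneg_right h2 h1]

theorem δ_sqrt_α_sq_le (h : Regime S β ν v b c C η α δ m κ k lam τ W T) :
    δ * √k * α ^ 2 ≤ τ := by
  have h1 : √k * α ≤ 1 := by
    calc _ ≤ p * α := mul_le_mul_of_nonneg_right h.sqrt_k_le h.α_pos.le
      _ ≤ 1 := by linarith [h.α_le, h.c_le]
  calc _ = δ * α * (√k * α) := by ring
    _ ≤ δ * α := mul_le_of_le_one_right (mul_nonneg h.δ_nonneg h.α_pos.le) h1
    _ ≤ τ := h.δα_le

/-- A cruder form, uniform in `j`, for counting drift. The factor `log (p / α)` in the bound on `δ`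
makes the transient part small enough to be summed over a burn-in of order `log (p / α) / (η m)`
steps. -/
theorem abs_b_le_rate (h : Regime S β ν v b c C η α δ m κ k lam τ W T) {t : ℕ}
    (hs : ∀ j ∈ S, |v t j - β j| ≤
      |ν j| + (floor S ν α δ W + (κ * m + α ^ 2) * decay p η α m t))
    (hw : ∀ j ∉ S, v t j ≤ 4 * α ^ 2) (j : Fin p) :
    |b t j| ≤ 8 * τ + c * m / Real.log (p / α) * decay p η α m t := by
  refine (h.abs_b_le hs hw j).trans ?_
  have h1 := h.floor_le
  have h2 := h.ν_le j
  have h3 := h.lam_le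
  have h4 : δ * √k ≤ 1 / 72 := h.δ_sqrt_le.trans h.c_le
  have h5 := mul_le_mul_of_nonneg_right h4 h.floor_nonneg
  have h6 := mul_le_mul_of_nonneg_right h.δ_sqrt_mul_le (h.decay_nonneg t)
  have h7 : δ * √k * α ^ 2 * decay p η α m t ≤ τ * 1 :=
    mul_le_mul h.δ_sqrt_α_sq_le (h.decay_le_one t) (h.decay_nonneg t) h.τ_nonneg
  have h8 := h.τ_nonneg
  nlinarith

theorem burnIn_le (h : Regime S β ν v b c C η α δ m κ k lam τ W T) :
    (burnIn p η α m : ℝ) ≤ 7 * Real.log (p / α) / (η * m) := by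
  have h0 := mul_pos h.η_pos h.m_pos
  have hL := h.one_le_L
  have h1 := Nat.ceil_lt_add_one (a := 6 * Real.log (p / α) / (η * m)) (by positivity)
  have h2 : 1 ≤ Real.log (p / α) / (η * m) := by
    rw [one_le_div h0]; linarith [h.ηm_le]
  unfold burnIn
  have e : 7 * Real.log (p / α) / (η * m) =
    6 * Real.log (p / α) / (η * m) + Real.log (p / α) / (η * m) := by ring
  linarith

/-- The drift budget: the steady part costs at most `40 / 100`, the transient part at most `36 c ≤ 1
/ 2`, and together they stay below `1 ≤ log 4`. -/
theorem growth_le (h : Regime S β ν v b c C η α δ m κ k lam τ W T) {t : ℕ} (ht : t ≤ T) :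
    4 * η * (10 * τ * t + c * m / Real.log (p / α) *
      ∑ i ∈ Finset.range t, decay p η α m i) ≤ Real.log 4 := by
  have h0 := mul_pos h.η_pos h.m_pos
  have hL := h.one_le_L
  have hL0 : 0 < Real.log (p / α) := by linarith
  have h1 : ∑ i ∈ Finset.range t, decay p η α m i ≤ 9 * Real.log (p / α) / (η * m) := by
    refine (sum_pow_sub_le (by linarith [h.ηm_le]) (by linarith) _ _).trans ?_
    have h2 : 1 / (1 - (1 - η * m / 2)) ≤ 2 * Real.log (p / α) / (η * m) := by
      rw [show 1 - (1 - η * m / 2) = η * m / 2 by ring, one_div_div]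
      gcongr; linarith
    have e : 9 * Real.log (p / α) / (η * m) =
      7 * Real.log (p / α) / (η * m) + 2 * Real.log (p / α) / (η * m) := by ring
    linarith [h.burnIn_le]
  have h2 : 4 * η * (c * m / Real.log (p / α) * ∑ i ∈ Finset.range t, decay p η α m i)
      ≤ 36 * c := by
    have h3 := h.η_pos
    have h4 := h.c_pos
    have h5 := h.m_pos
    calc _ ≤ 4 * η * (c * m / Real.log (p / α) * (9 * Real.log (p / α) / (η * m))) := by gcongr
      _ = 36 * c := by field_simp; ring
  have h3 : η * τ * t ≤ 1 / 100 := by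
    refine le_trans ?_ h.horizon_le
    rw [mul_comm (T : ℝ)]
    have := h.τ_nonneg
    have := h.η_pos
    gcongr
  have h4 : 1 ≤ Real.log 4 := by
    rw [show (4 : ℝ) = 2 ^ 2 by norm_num, Real.log_pow]
    have := Real.log_two_gt_d9
    push_cast; linarith
  have := h.c_le
  linarith

end Regime
end HadamardGD

/-! ### Induction in time and the error at the horizon. -/

namespace HadamardGD

theorem exp_half_le_one_add {x : ℝ} (h0 : 0 ≤ x) (h1 : x ≤ 1) : Real.exp (x / 2) ≤ 1 + x := by
  have h2 := Real.add_one_le_exp (-(x / 2))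
  rw [Real.exp_neg] at h2
  have h3 := Real.exp_pos (x / 2)
  rw [le_inv_comm₀ (by linarith) h3] at h2
  refine h2.trans ?_
  rw [inv_le_iff_one_le_mul₀ (by linarith)]
  nlinarith

namespace Regime

variable {p : ℕ} {S : Finset (Fin p)} {β ν : Fin p → ℝ} {v b : ℕ → Fin p → ℝ}
  {c C η α δ m κ k lam τ W : ℝ} {T : ℕ}

/-- Since `1 + x ≥ exp (x / 2)` on `[0, 1]`, the `6` in `burnIn` yields growth `(p / α) ^ 3`. Then
`α ^ 2` times it is at least `1 / α ≥ C`, which dominates every signal because `κ m ≤ C`. -/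
theorem le_growth (h : Regime S β ν v b c C η α δ m κ k lam τ W T) {t : ℕ}
    (ht : burnIn p η α m ≤ t) : C ≤ α ^ 2 * (1 + η * m) ^ t := by
  have h0 := mul_pos h.η_pos h.m_pos
  have hα := h.α_pos
  have h1 : 6 * Real.log (p / α) ≤ t * (η * m) := by
    rw [← div_le_iff₀ h0]
    exact (Nat.le_ceil _).trans (by exact_mod_cast ht)
  have hp := h.one_le_p
  have h2 : (p / α) ^ 3 ≤ (1 + η * m) ^ t := by
    calc _ = Real.exp (3 * Real.log (p / α)) := by
          rw [show (3 : ℝ) = (3 : ℕ) by norm_num, Real.exp_nat_mul, Real.exp_log (by positivity)]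
      _ ≤ Real.exp (t * (η * m / 2)) := Real.exp_le_exp.2 (by linarith)
      _ = Real.exp (η * m / 2) ^ t := Real.exp_nat_mul _ _
      _ ≤ _ := by
        gcongr
        exact exp_half_le_one_add h0.le (by linarith [h.ηm_le])
  have h3 : C * α ≤ 1 := by
    have := h.cC_le
    have := h.C_pos
    nlinarith [h.α_le_c]
  have h4 : (1 : ℝ) ≤ p ^ 3 := one_le_pow₀ hp
  calc C = C * α / α := by field_simp
    _ ≤ 1 / α := by gcongr
    _ ≤ p ^ 3 / α := by gcongr
    _ = α ^ 2 * (p / α) ^ 3 := by field_simp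
    _ ≤ _ := by gcongr

theorem abs_strong_succ_le (h : Regime S β ν v b c C η α δ m κ k lam τ W T) {t : ℕ}
    (hs : ∀ j ∈ S, |v t j - β j| ≤
      |ν j| + (floor S ν α δ W + (κ * m + α ^ 2) * decay p η α m t))
    (hg : ∀ j ∈ S, min (β j / 2) (α ^ 2 * (1 + η * m) ^ t) ≤ v t j)
    (hw : ∀ j ∉ S, v t j ≤ 4 * α ^ 2) {j : Fin p} (hj : j ∈ S) :
    |v (t + 1) j - β j| ≤
        |ν j| + (floor S ν α δ W + (κ * m + α ^ 2) * decay p η α m (t + 1)) ∧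
      min (β j / 2) (α ^ 2 * (1 + η * m) ^ (t + 1)) ≤ v (t + 1) j := by
  have hη := h.η_pos
  have hm := h.m_pos
  have hηm := mul_pos hη hm
  have hκm : 0 ≤ κ * m := by have := h.one_le_κ; positivity
  have hv := h.v_nonneg t j
  have hF := h.floor_nonneg
  have hF3 := h.floor_le
  have hd0 := h.decay_nonneg t
  have hd1 := h.decay_le_one t
  have hτ0 := h.τ_nonneg
  have hτ := h.τ_le
  have hν : |ν j| ≤ 4 * τ := (h.ν_le j).trans (by linarith [h.lam_le])
  have hb := h.abs_b_le_half hs hw j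
  have hb' : |b t j| ≤ m / 4 := by
    refine (h.abs_b_le_rate hs hw j).trans ?_
    have h1 : c * m / Real.log (p / α) * decay p η α m t ≤ m / 72 * 1 := by
      refine mul_le_mul ?_ hd1 hd0 (by positivity)
      rw [div_le_iff₀ (by linarith [h.one_le_L])]
      nlinarith [h.one_le_L, h.c_le]
    linarith
  have hR : (κ * m + α ^ 2) * decay p η α m t ≤ κ * m + α ^ 2 :=
    mul_le_of_le_one_right (by positivity) hd1
  have hdist : |v t j - β j| ≤ κ * m + α ^ 2 + m / 100 := by
    refine (hs j hj).trans ?_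
    linarith
  have hmκ : m ≤ κ * m := by nlinarith [h.one_le_κ]
  have hηκm := h.η_κm_le
  have hηα := h.η_α_sq_le
  have hηm' := h.ηm_le
  have hv1 : 6 * (η * v t j) ≤ 1 := by
    have h1 : v t j ≤ 2 * (κ * m) + α ^ 2 + m / 100 := by
      linarith [le_abs_self (v t j - β j), h.β_le j]
    have := mul_le_mul_of_nonneg_left h1 hη.le
    linarith
  have hx : |η * (v t j - β j + b t j)| ≤ 1 / 2 := by
    rw [abs_mul, abs_of_pos hη]
    have h1 : |v t j - β j + b t j| ≤ κ * m + α ^ 2 + m / 100 + m / 4 :=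
      (abs_add_le _ _).trans (add_le_add hdist hb')
    have := mul_le_mul_of_nonneg_left h1 hη.le
    linarith
  rw [h.v_succ]
  constructor
  · obtain ⟨θ, hθ1, hθ2, hθ⟩ := abs_step_sub_le hη hv hx hv1
    have hθ0 : 0 ≤ θ := le_trans (by positivity) hθ1
    set G := (κ * m + α ^ 2) * decay p η α m t with hG
    have hG0 : 0 ≤ G := by positivity
    have h1 : |v t j * (1 - 2 * η * (v t j - β j + b t j)) ^ 2 - β j| ≤
        |ν j| + (floor S ν α δ W + (1 - θ / 2) * G) := by
      refine hθ.trans ?_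
      have h2 := mul_le_mul_of_nonneg_left (hs j hj) (sub_nonneg.2 hθ2)
      have h3 := mul_le_mul_of_nonneg_left hb hθ0
      linarith
    refine h1.trans ?_
    -- During the burn-in the exponent of `decay` is truncated to zero, so the transient only has to
    -- not increase. Afterwards `v t j ≥ β j / 2 ≥ m / 2` gives `θ ≥ η m`, the contraction rate of
    -- `decay`.
    rcases lt_or_ge t (burnIn p η α m) with ht | ht
    · have e : decay p η α m (t + 1) = decay p η α m t := by
        unfold decay
        rw [Nat.sub_eq_zero_of_le ht.le, Nat.sub_eq_zero_of_le ht]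
      rw [e, ← hG]
      have := mul_nonneg hθ0 hG0
      linarith
    · have e : decay p η α m (t + 1) = decay p η α m t * (1 - η * m / 2) := by
        unfold decay
        rw [Nat.succ_sub ht, pow_succ]
      have hβ : β j / 2 ≤ v t j := by
        refine le_trans (le_min le_rfl ?_) (hg j hj)
        have := h.le_growth ht
        have := h.κm_le
        linarith [h.β_le j]
      have h2 : η * m ≤ θ := by
        refine le_trans ?_ hθ1
        have : m ≤ 2 * v t j := by linarith [h.le_β j hj]
        nlinarith
      have h3 : (κ * m + α ^ 2) * decay p η α m (t + 1) = G * (1 - η * m / 2) := by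
        rw [e, hG]; ring
      rw [h3]
      nlinarith
  · rw [pow_succ (1 + η * m), ← mul_assoc]
    exact min_le_step hη hm (h.le_β j hj) hv hb' hv1 (hg j hj)

theorem weak_succ_le (h : Regime S β ν v b c C η α δ m κ k lam τ W T) {t : ℕ}
    (hs : ∀ j ∈ S, |v t j - β j| ≤
      |ν j| + (floor S ν α δ W + (κ * m + α ^ 2) * decay p η α m t))
    (hw : ∀ j ∉ S, v t j ≤ 4 * α ^ 2) {j : Fin p} (hj : j ∉ S) :
    v (t + 1) j ≤ v t j *
      Real.exp (4 * η * (10 * τ + c * m / Real.log (p / α) * decay p η α m t)) := by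
  have hη := h.η_pos
  have hv := h.v_nonneg t j
  have hv1 : 6 * (η * v t j) ≤ 1 := by
    have := mul_le_mul_of_nonneg_left (hw j hj) hη.le
    linarith [h.η_α_sq_le]
  rw [h.v_succ]
  refine (step_le_mul_exp hη hv (h.β_nonneg j) hv1).trans ?_
  have h1 : β j + |b t j| ≤ 10 * τ + c * m / Real.log (p / α) * decay p η α m t := by
    linarith [h.abs_b_le_rate hs hw j, h.β_weak j hj, h.lam_le]
  rw [mul_assoc 4 η]
  gcongr

/-- A bare bound `4 * α ^ 2` off `S` would not be inductive; the accumulated exponent is carried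
instead and converted by `growth_le` at each step. -/
theorem invariants (h : Regime S β ν v b c C η α δ m κ k lam τ W T) {t : ℕ} (ht : t ≤ T) :
    (∀ j ∈ S, |v t j - β j| ≤
        |ν j| + (floor S ν α δ W + (κ * m + α ^ 2) * decay p η α m t)) ∧
      (∀ j ∈ S, min (β j / 2) (α ^ 2 * (1 + η * m) ^ t) ≤ v t j) ∧
      (∀ j ∉ S, v t j ≤ α ^ 2 * Real.exp (4 * η * (10 * τ * t + c * m / Real.log (p / α) *
        ∑ i ∈ Finset.range t, decay p η α m i))) := by
  induction t with
  | zero =>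
    refine ⟨fun j hj => ?_, fun j hj => ?_, fun j hj => ?_⟩
    · have hκm : 0 ≤ κ * m := by have := h.one_le_κ; have := h.m_pos; positivity
      have : |v 0 j - β j| ≤ κ * m + α ^ 2 := by
        rw [h.v_zero, abs_le]
        constructor <;> linarith [h.β_le j, h.β_nonneg j, sq_nonneg α]
      simp only [decay, zero_tsub, pow_zero, mul_one]
      linarith [abs_nonneg (ν j), h.floor_nonneg]
    · rw [h.v_zero]; simp
    · rw [h.v_zero]; simp
  | succ t ih =>
    obtain ⟨hs, hg, hw⟩ := ih (by omega)
    have hw4 : ∀ j ∉ S, v t j ≤ 4 * α ^ 2 := fun j hj => by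
      refine (hw j hj).trans ?_
      rw [mul_comm]
      gcongr
      rw [← Real.le_log_iff_exp_le (by norm_num)]
      exact h.growth_le (by omega)
    refine ⟨fun j hj => (h.abs_strong_succ_le hs hg hw4 hj).1,
      fun j hj => (h.abs_strong_succ_le hs hg hw4 hj).2, fun j hj => ?_⟩
    refine (h.weak_succ_le hs hw4 hj).trans ?_
    refine (mul_le_mul_of_nonneg_right (hw j hj) (Real.exp_pos _).le).trans (le_of_eq ?_)
    rw [mul_assoc, ← Real.exp_add, Finset.sum_range_succ]
    congr 2
    push_cast; ring

theorem weak_le (h : Regime S β ν v b c C η α δ m κ k lam τ W T) {j : Fin p} (hj : j ∉ S) :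
    v T j ≤ 4 * α ^ 2 := by
  refine ((h.invariants le_rfl).2.2 j hj).trans ?_
  rw [mul_comm]
  gcongr
  rw [← Real.le_log_iff_exp_le (by norm_num)]
  exact h.growth_le le_rfl

/-- The constant `13` splits as `7 + 6`: at most `7 log (p / α) / (η m)` steps of burn-in, and the
rest contracts at rate `η m / 2`, shrinking the transient to `(α / p) ^ 3`. -/
theorem decay_horizon_le (h : Regime S β ν v b c C η α δ m κ k lam τ W T) :
    √k * ((κ * m + α ^ 2) * decay p η α m T) ≤ α := by
  have h0 := mul_pos h.η_pos h.m_pos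
  have hα := h.α_pos
  have hp := h.one_le_p
  have hL := h.one_le_L
  have h1 : 6 * Real.log (p / α) ≤ (T - burnIn p η α m : ℕ) * (η * m) := by
    have h2 : (T : ℝ) - burnIn p η α m ≤ (T - burnIn p η α m : ℕ) := by
      rw [sub_le_iff_le_add]
      exact_mod_cast (by omega : T ≤ T - burnIn p η α m + burnIn p η α m)
    have h3 := h.le_horizon
    have h4 := h.burnIn_le
    have e : 13 * Real.log (p / α) / (η * m) - 7 * Real.log (p / α) / (η * m) =
      6 * Real.log (p / α) / (η * m) := by ring
    rw [← div_le_iff₀ h0]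
    linarith
  have h2 : decay p η α m T ≤ (α / p) ^ 3 := by
    calc _ ≤ Real.exp (-(η * m / 2)) ^ (T - burnIn p η α m) := by
          refine pow_le_pow_left₀ (by linarith [h.ηm_le]) ?_ _
          linarith [Real.add_one_le_exp (-(η * m / 2))]
      _ = Real.exp ((T - burnIn p η α m : ℕ) * -(η * m / 2)) := (Real.exp_nat_mul _ _).symm
      _ ≤ Real.exp (3 * -Real.log (p / α)) := Real.exp_le_exp.2 (by linarith)
      _ = _ := by
        rw [show (3 : ℝ) = (3 : ℕ) by norm_num, Real.exp_nat_mul, Real.exp_neg,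
          Real.exp_log (by positivity), inv_div]
  have h3 : C * α ≤ 1 / 72 := by
    have := h.cC_le
    have := h.C_pos
    nlinarith [h.α_le_c]
  have hα1 : α ≤ 1 / 72 := h.α_le_c.trans h.c_le
  have hC := h.C_pos
  have h4 : (C + α ^ 2) * α ^ 2 ≤ 1 := by nlinarith [sq_nonneg α, pow_pos hα 3]
  have hκm : 0 ≤ κ * m := by have := h.one_le_κ; have := h.m_pos; positivity
  calc _ ≤ p * ((C + α ^ 2) * (α / p) ^ 3) := by
        have := h.decay_nonneg T
        have := h.sqrt_k_le
        have := h.κm_le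
        gcongr
    _ = (C + α ^ 2) * α ^ 2 * α / p ^ 2 := by field_simp
    _ ≤ 1 * α / p ^ 2 := by gcongr
    _ ≤ 1 * α / 1 := by gcongr; exact one_le_pow₀ hp
    _ = α := by ring

theorem sum_sq_le (h : Regime S β ν v b c C η α δ m κ k lam τ W T) :
    ∑ j, (v T j - β j) ^ 2 ≤ 6 * ∑ j ∈ S, ν j ^ 2 + 5 * W ^ 2 + 7 * α ^ 2 := by
  have hα := h.α_pos
  have hα1 : α ≤ 1 / 72 := h.α_le_c.trans h.c_le
  have hk : √k ^ 2 = k := Real.sq_sqrt (by linarith [h.one_le_k])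
  have hN : noise S ν ^ 2 = ∑ j ∈ S, ν j ^ 2 := Real.sq_sqrt (by positivity)
  set G := (κ * m + α ^ 2) * decay p η α m T with hG
  have hκm : 0 ≤ κ * m := by have := h.one_le_κ; have := h.m_pos; positivity
  have hG0 : 0 ≤ G := by have := h.decay_nonneg T; positivity
  have hF0 := h.floor_nonneg
  have hstrong : ∑ j ∈ S, (v T j - β j) ^ 2 ≤
      3 * ∑ j ∈ S, ν j ^ 2 + 3 * (√k * floor S ν α δ W) ^ 2 + 3 * (√k * G) ^ 2 := by
    calc _ ≤ ∑ j ∈ S, (3 * ν j ^ 2 + (3 * floor S ν α δ W ^ 2 + 3 * G ^ 2)) := by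
          refine Finset.sum_le_sum fun j hj => ?_
          have h1 := (h.invariants le_rfl).1 j hj
          rw [← hG] at h1
          have h2 : |v T j - β j| ^ 2 ≤ (|ν j| + (floor S ν α δ W + G)) ^ 2 := by gcongr
          rw [sq_abs] at h2
          rw [← sq_abs (ν j)]
          nlinarith [sq_nonneg (|ν j| - floor S ν α δ W), sq_nonneg (|ν j| - G),
            sq_nonneg (floor S ν α δ W - G)]
      _ = 3 * ∑ j ∈ S, ν j ^ 2 + S.card * (3 * floor S ν α δ W ^ 2 + 3 * G ^ 2) := by
          rw [Finset.sum_add_distrib, ← Finset.mul_sum, Finset.sum_const, nsmul_eq_mul]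
      _ ≤ 3 * ∑ j ∈ S, ν j ^ 2 + k * (3 * floor S ν α δ W ^ 2 + 3 * G ^ 2) := by
          gcongr; exact h.card_le
      _ = _ := by rw [mul_pow √k, mul_pow √k, hk]; ring
  have hweak : ∑ j ∈ Sᶜ, (v T j - β j) ^ 2 ≤ α ^ 2 + 2 * W ^ 2 := by
    calc _ ≤ ∑ j ∈ Sᶜ, (32 * α ^ 4 + 2 * β j ^ 2) := by
          refine Finset.sum_le_sum fun j hj => ?_
          have h1 := h.weak_le (Finset.mem_compl.1 hj)
          have h2 := h.v_nonneg T j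
          have h3 : v T j ^ 2 ≤ (4 * α ^ 2) ^ 2 := by gcongr
          nlinarith [sq_nonneg (v T j + β j)]
      _ = Sᶜ.card * (32 * α ^ 4) + 2 * ∑ j ∈ Sᶜ, β j ^ 2 := by
          rw [Finset.sum_add_distrib, ← Finset.mul_sum _ _ 2, Finset.sum_const, nsmul_eq_mul]
      _ ≤ p * (32 * α ^ 4) + 2 * W ^ 2 := by
          gcongr
          · exact_mod_cast (Finset.card_le_univ _).trans_eq (Fintype.card_fin p)
          · exact h.sum_β_le
      _ ≤ α ^ 2 + 2 * W ^ 2 := by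
          have h1 : p * α ≤ 1 / 72 := h.α_le.trans h.c_le
          have h2 : 32 * (p * α) * α ≤ 1 := by nlinarith
          have : p * (32 * α ^ 4) = 32 * (p * α) * α * α ^ 2 := by ring
          rw [this]
          nlinarith [sq_nonneg α]
  have hG' : (√k * G) ^ 2 ≤ α ^ 2 := by
    have := h.decay_horizon_le
    gcongr
  -- Since `δ √k` is small, the floor summed over up to `k` strong coordinates costs no more than
  -- the terms it is built from.
  have hF' : (√k * floor S ν α δ W) ^ 2 ≤ noise S ν ^ 2 + W ^ 2 + α ^ 2 := by
    have h1 : δ * √k ≤ 1 / 72 := h.δ_sqrt_le.trans h.c_le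
    have h2 := noise_nonneg (S := S) (ν := ν)
    have h3 := h.W_nonneg
    have h4 : √k * floor S ν α δ W ≤ 2 * (1 / 72) * (noise S ν + W + α) := by
      calc _ = 2 * (δ * √k) * (noise S ν + W + α) := by unfold floor; ring
        _ ≤ _ := by gcongr
    calc _ ≤ (2 * (1 / 72) * (noise S ν + W + α)) ^ 2 := by gcongr
      _ ≤ _ := by
        nlinarith [sq_nonneg (noise S ν - W), sq_nonneg (noise S ν - α), sq_nonneg (W - α)]
  rw [← Finset.sum_add_sum_compl S]
  nlinarith

end Regime
end HadamardGD

/-! ### The restricted isometry property and the perturbation of the iteration. -/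

namespace HadamardGD

theorem sqNorm_nonneg {k : ℕ} (v : Fin k → ℝ) : 0 ≤ sqNorm v :=
  Finset.sum_nonneg fun _ _ => sq_nonneg _

theorem sqNorm_eq_dotProduct {k : ℕ} (v : Fin k → ℝ) : sqNorm v = v ⬝ᵥ v := by
  simp [sqNorm, dotProduct, sq]

theorem sqNorm_smul {k : ℕ} (r : ℝ) (v : Fin k → ℝ) : sqNorm (r • v) = r ^ 2 * sqNorm v := by
  simp [sqNorm, mul_pow, Finset.mul_sum]

theorem sqNorm_single {k : ℕ} (j : Fin k) (r : ℝ) : sqNorm (Pi.single j r) = r ^ 2 := by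
  rw [sqNorm, Finset.sum_eq_single j] <;> simp +contextual

theorem mem_supp {p : ℕ} {β : Fin p → ℝ} {j : Fin p} : j ∈ supp β ↔ β j ≠ 0 := by
  simp [supp]

variable {n p : ℕ} {X : Matrix (Fin n) (Fin p) ℝ} {k : ℕ} {δ : ℝ}

theorem RIP.nonneg (h : RIP X k δ) (hk : 1 ≤ k) (j : Fin p) : 0 ≤ δ := by
  have h1 := h (Pi.single j 1) (by
    refine le_trans (Finset.card_le_card (t := {j}) fun i hi => ?_) (by simpa using hk)
    by_contra hij
    rw [Finset.mem_singleton] at hij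
    exact (mem_supp.1 hi) (by simp [hij]))
  rw [sqNorm_single] at h1
  linarith [h1.1, h1.2]

/-- The deviation of the normalized Gram matrix from the identity. -/
noncomputable def gramDev (X : Matrix (Fin n) (Fin p) ℝ) (a : Fin p → ℝ) (j : Fin p) : ℝ :=
  (1 / (n : ℝ)) * (Xᵀ *ᵥ (X *ᵥ a)) j - a j

theorem gramDev_add (a a' : Fin p → ℝ) (j : Fin p) :
    gramDev X (a + a') j = gramDev X a j + gramDev X a' j := by
  simp only [gramDev, Matrix.mulVec_add, Pi.add_apply]; ring

theorem gramDev_eq_sum (a : Fin p → ℝ) (j : Fin p) :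
    gramDev X a j = ∑ i, a i * gramDev X (Pi.single i 1) j := by
  have h1 : ∀ i, gramDev X (Pi.single i (a i)) j = a i * gramDev X (Pi.single i 1) j := by
    intro i
    have e : Pi.single i (a i) = a i • (Pi.single i 1 : Fin p → ℝ) := by
      rw [← Pi.single_smul, smul_eq_mul, mul_one]
    rw [e]
    simp only [gramDev, Matrix.mulVec_smul, Pi.smul_apply, smul_eq_mul]; ring
  have h2 : ∀ s : Finset (Fin p), gramDev X (∑ i ∈ s, Pi.single i (a i)) j =
      ∑ i ∈ s, a i * gramDev X (Pi.single i 1) j := by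
    intro s
    induction s using Finset.induction_on with
    | empty => simp [gramDev]
    | insert i s hi ih => rw [Finset.sum_insert hi, Finset.sum_insert hi, gramDev_add, ih, h1]
  rw [← h2, Finset.univ_sum_single]

/-- Polarization: subtract the RIP bounds for `a + r e_j` and `a - r e_j`. The choice `r = ‖a‖`
balances the two squared norms. -/
theorem RIP.abs_gramDev_le (h : RIP X k δ) {a : Fin p → ℝ} {j : Fin p}
    (hcard : (insert j (supp a)).card ≤ k) : |gramDev X a j| ≤ δ * √(sqNorm a) := by
  have hs : ∀ r : ℝ, (supp (a + Pi.single j r)).card ≤ k := fun r => by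
    refine (Finset.card_le_card fun i hi => ?_).trans hcard
    rw [Finset.mem_insert, mem_supp]
    by_contra! hij
    exact (mem_supp.1 hi) (by simp [hij.1, hij.2])
  set r := √(sqNorm a) with hr
  have hr2 : r ^ 2 = sqNorm a := Real.sq_sqrt (sqNorm_nonneg a)
  rcases (Real.sqrt_nonneg (sqNorm a)).eq_or_lt with h0 | h0
  · have : a = 0 := by
      have h1 : sqNorm a = 0 := by rw [← hr2, hr, ← h0]; simp
      funext i
      have := (Finset.sum_eq_zero_iff_of_nonneg fun i _ => sq_nonneg (a i)).1 h1 i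
        (Finset.mem_univ _)
      simpa using this
    rw [hr, ← h0, this]; simp [gramDev]
  · have h1 := h _ (hs r)
    have h2 := h _ (hs (-r))
    have e1 : ∀ r : ℝ, sqNorm (a + Pi.single j r) = sqNorm a + 2 * r * a j + r ^ 2 := by
      intro r
      simp only [sqNorm_eq_dotProduct, add_dotProduct, dotProduct_add, single_dotProduct,
        dotProduct_single, Pi.add_apply, Pi.single_eq_same]
      ring
    have e2 : ∀ r : ℝ, sqNorm (X *ᵥ (a + Pi.single j r)) =
        sqNorm (X *ᵥ a) + 2 * r * (Xᵀ *ᵥ (X *ᵥ a)) j +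
          r ^ 2 * sqNorm (X *ᵥ Pi.single j 1) := by
      intro r
      have e3 : X *ᵥ Pi.single j r = r • X *ᵥ Pi.single j 1 := by
        rw [← Matrix.mulVec_smul, ← Pi.single_smul, smul_eq_mul, mul_one]
      have e4 : (Xᵀ *ᵥ (X *ᵥ a)) j = (X *ᵥ a) ⬝ᵥ (X *ᵥ Pi.single j 1) := by
        rw [Matrix.mulVec_single_one, dotProduct_comm]; rfl
      rw [Matrix.mulVec_add, e3, e4]
      simp only [sqNorm_eq_dotProduct, add_dotProduct, dotProduct_add, smul_dotProduct,
        dotProduct_smul, smul_eq_mul]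
      rw [dotProduct_comm (X *ᵥ Pi.single j 1) (X *ᵥ a)]
      ring
    rw [e1, e2, ← hr2] at h1 h2
    rw [← hr] at h0
    have h3 : |4 * r * gramDev X a j| ≤ 4 * r * (δ * r) := by
      unfold gramDev
      rw [abs_le]
      constructor <;> nlinarith [h1.1, h1.2, h2.1, h2.2]
    rw [abs_mul, abs_of_pos (by positivity)] at h3
    exact le_of_mul_le_mul_left h3 (by positivity)

/-- For a vector without sparsity only the entrywise bound is available, at the price of the ℓ₁
norm. It is applied to coordinates of size `α ^ 2`, whose total mass is at most `α`. -/
theorem RIP.abs_gramDev_le_sum (h : RIP X k δ) (hk : 2 ≤ k) (a : Fin p → ℝ) (j : Fin p) :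
    |gramDev X a j| ≤ δ * ∑ i, |a i| := by
  rw [gramDev_eq_sum, Finset.mul_sum]
  refine (Finset.abs_sum_le_sum_abs _ _).trans (Finset.sum_le_sum fun i _ => ?_)
  rw [abs_mul, mul_comm]
  refine mul_le_mul_of_nonneg_right ?_ (abs_nonneg _)
  have h1 := h.abs_gramDev_le (a := Pi.single i 1) (j := j) (by
    refine le_trans (Finset.card_le_card (t := {j, i}) fun l hl => ?_)
      (Finset.card_le_two.trans hk)
    rw [Finset.mem_insert, mem_supp] at hl
    rw [Finset.mem_insert, Finset.mem_singleton]
    by_contra! hij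
    rcases hl with hl | hl
    · exact hij.1 hl
    · exact hl (by simp [hij.2]))
  simpa [sqNorm_single] using h1

/-- The normalized correlations of the noise with the columns of `X`, `n⁻¹ Xᵀ w`. -/
noncomputable def noiseCorr (X : Matrix (Fin n) (Fin p) ℝ) (w : Fin n → ℝ) : Fin p → ℝ :=
  (1 / (n : ℝ)) • (Xᵀ *ᵥ w)

theorem gdIter_succ_sq (β : Fin p → ℝ) (w : Fin n → ℝ) (η α : ℝ) (t : ℕ) (j : Fin p) :
    (gdIter X (X *ᵥ β + w) η α (t + 1) ^ 2) j =
      (gdIter X (X *ᵥ β + w) η α t ^ 2) j *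
        (1 - 2 * η * ((gdIter X (X *ᵥ β + w) η α t ^ 2) j - β j +
          (gramDev X (gdIter X (X *ᵥ β + w) η α t ^ 2 - β) j - noiseCorr X w j))) ^ 2 := by
  simp only [gdIter]
  set u := gdIter X (X *ᵥ β + w) η α t
  have e : X *ᵥ (u ^ 2) - (X *ᵥ β + w) = X *ᵥ (u ^ 2 - β) - w := by
    rw [Matrix.mulVec_sub]; abel
  simp only [lossGrad, gramDev, noiseCorr, e, Matrix.mulVec_sub Xᵀ, Pi.pow_apply, Pi.sub_apply,
    Pi.smul_apply, Pi.mul_apply, smul_eq_mul]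
  ring

theorem RIP.abs_gramDev_sub_le (h : RIP X k δ) {β v : Fin p → ℝ} {S : Finset (Fin p)}
    (hS : S ⊆ supp β) (hk : (supp β).card + 1 ≤ k) (hk2 : 2 ≤ k) (hv : ∀ j, 0 ≤ v j)
    (j : Fin p) :
    |gramDev X (v - β) j| ≤
      δ * (√(∑ i ∈ S, (v i - β i) ^ 2) + √(∑ i ∈ Sᶜ, β i ^ 2) + ∑ i ∈ Sᶜ, v i) := by
  have hδ := h.nonneg (by omega) j
  -- The weak signal `-β` goes into `a`, which keeps `a` supported in `supp β`; only `v` off `S` is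
  -- left to the dense remainder `e`.
  set a : Fin p → ℝ := fun i => if i ∈ S then v i - β i else -β i with ha
  set e : Fin p → ℝ := fun i => if i ∈ S then 0 else v i with he
  have hsplit : v - β = a + e := by
    funext i
    by_cases hi : i ∈ S <;> simp [a, e, hi]; ring
  have ha1 : sqNorm a = ∑ i ∈ S, (v i - β i) ^ 2 + ∑ i ∈ Sᶜ, β i ^ 2 := by
    rw [sqNorm, ← Finset.sum_add_sum_compl S]
    congr 1
    · exact Finset.sum_congr rfl fun i hi => by simp [a, hi]
    · exact Finset.sum_congr rfl fun i hi => by simp [a, Finset.mem_compl.1 hi]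
  have he1 : ∑ i, |e i| = ∑ i ∈ Sᶜ, v i := by
    rw [← Finset.sum_add_sum_compl S, Finset.sum_eq_zero (s := S), zero_add]
    · exact Finset.sum_congr rfl fun i hi => by
        simp [e, Finset.mem_compl.1 hi, abs_of_nonneg (hv i)]
    · exact fun i hi => by simp [e, hi]
  have hasupp : supp a ⊆ supp β := fun i hi => by
    by_cases hiS : i ∈ S
    · exact hS hiS
    · rw [mem_supp] at hi ⊢
      simpa [a, hiS] using hi
  have h1 := h.abs_gramDev_le (a := a) (j := j) (by
    have := Finset.card_insert_le j (supp a)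
    have := Finset.card_le_card hasupp
    omega)
  have h2 := h.abs_gramDev_le_sum hk2 e j
  rw [hsplit, gramDev_add]
  refine (abs_add_le _ _).trans ?_
  rw [he1] at h2
  have h3 : √(sqNorm a) ≤ √(∑ i ∈ S, (v i - β i) ^ 2) + √(∑ i ∈ Sᶜ, β i ^ 2) := by
    rw [ha1, Real.sqrt_le_iff]
    refine ⟨by positivity, ?_⟩
    rw [add_sq, Real.sq_sqrt (by positivity), Real.sq_sqrt (by positivity)]
    linarith [mul_nonneg (Real.sqrt_nonneg (∑ i ∈ S, (v i - β i) ^ 2))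
      (Real.sqrt_nonneg (∑ i ∈ Sᶜ, β i ^ 2))]
  have h4 := mul_le_mul_of_nonneg_left h3 hδ
  linarith

end HadamardGD

/-! ### Strong and weak signals, and the deterministic error bound. -/

namespace HadamardGD

variable {n p : ℕ} {σ : ℝ} {β : Fin p → ℝ}

theorem strongSet_subset : strongSet n σ β ⊆ supp β := Finset.filter_subset _ _

theorem weakSet_subset : weakSet n σ β ⊆ supp β := Finset.filter_subset _ _

/-- When `log p ≤ 1` the strong threshold does not exceed the weak one. When `log p > 1` the two
sets are disjoint, so the count of `supp β` forces them to exhaust it. -/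
theorem mem_weakSet_of_notMem_strongSet (hσ : 0 ≤ σ)
    (hcard : (supp β).card = (strongSet n σ β).card + (weakSet n σ β).card) {j : Fin p}
    (hj : j ∈ supp β) (hjs : j ∉ strongSet n σ β) : j ∈ weakSet n σ β := by
  rcases le_or_gt (Real.log p) 1 with hp | hp
  · simp only [strongSet, weakSet, Finset.mem_filter, not_and, not_le] at hjs ⊢
    refine ⟨hj, (hjs hj).le.trans ?_⟩
    have : 2 * σ * Real.log p ≤ 2 * σ := mul_le_of_le_one_right (by positivity) hp
    exact mul_le_mul_of_nonneg_right this (Real.sqrt_nonneg _)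
  · have hdisj : Disjoint (strongSet n σ β) (weakSet n σ β) := by
      rw [Finset.disjoint_left]
      intro i hi hi'
      simp only [strongSet, weakSet, Finset.mem_filter, mem_supp] at hi hi'
      have h1 : 0 < |β i| := abs_pos.2 hi.1
      have h2 : 0 ≤ 2 * σ * √(Real.log p / n) := by positivity
      nlinarith [hi.2, hi'.2]
    have hunion : strongSet n σ β ∪ weakSet n σ β = supp β := by
      refine Finset.eq_of_subset_of_card_le
        (Finset.union_subset strongSet_subset weakSet_subset) ?_
      rw [Finset.card_union_of_disjoint hdisj, hcard]
    rw [← hunion, Finset.mem_union] at hj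
    exact hj.resolve_left hjs

/-- The strong set is upward closed in `|β|`: a level above `|β j|` would select a subset of it
missing `j`, hence too few indices. -/
theorem kthLargest_set_le {r : ℝ}
    (hr : (strongSet n σ β).card ≤ (Finset.univ.filter fun j => r ≤ |β j|).card) {j : Fin p}
    (hj : j ∈ strongSet n σ β) : r ≤ |β j| := by
  by_contra! hlt
  refine absurd hr (not_le.2 (Finset.card_lt_card ⟨fun i hi => ?_, fun hsub => ?_⟩))
  · have h1 := (Finset.mem_filter.1 hi).2
    simp only [strongSet, Finset.mem_filter, mem_supp] at hj ⊢
    refine ⟨abs_pos.1 ?_, ?_⟩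
    · linarith [abs_nonneg (β j)]
    · linarith [hj.2]
  · have := (Finset.mem_filter.1 (hsub hj)).2
    linarith

theorem minStrength_le {j : Fin p} (hj : j ∈ strongSet n σ β) : minStrength n σ β ≤ |β j| := by
  refine csSup_le ⟨0, ?_⟩ fun r hr => kthLargest_set_le hr hj
  simpa using Finset.card_le_univ (strongSet n σ β)

theorem minStrength_pos (h : (strongSet n σ β).Nonempty) : 0 < minStrength n σ β := by
  obtain ⟨i, hi, hmin⟩ := Finset.exists_min_image _ (fun j => |β j|) h
  have h0 : 0 < |β i| := abs_pos.2 (mem_supp.1 (strongSet_subset hi))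
  refine h0.trans_le (le_csSup ⟨|β i|, fun r hr => kthLargest_set_le hr hi⟩ ?_)
  exact Finset.card_le_card fun j hj => by simpa using hmin j hj

theorem abs_le_condNumber_mul (h : (strongSet n σ β).Nonempty) (j : Fin p) :
    |β j| ≤ condNumber n σ β * minStrength n σ β := by
  rw [condNumber, div_mul_cancel₀ _ (minStrength_pos h).ne']
  exact le_ciSup (f := fun j => |β j|) (Set.finite_range _).bddAbove j

theorem one_le_condNumber (h : (strongSet n σ β).Nonempty) : 1 ≤ condNumber n σ β := by
  obtain ⟨j, hj⟩ := h
  have h1 := minStrength_pos ⟨j, hj⟩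
  have h2 := (minStrength_le hj).trans (abs_le_condNumber_mul ⟨j, hj⟩ j)
  exact le_of_mul_le_mul_right (by rwa [one_mul]) h1

/-- The bound on the error of gradient descent on the event that the noise is well behaved. -/
theorem sqNorm_gdIter_sub_le {X : Matrix (Fin n) (Fin p) ℝ} {C₀ α η δ M : ℝ} {w : Fin n → ℝ}
    {t : ℕ} (hC₀ : 0 < C₀) (hσ : 0 ≤ σ)
    (hβ : ∀ j, 0 ≤ β j) (hs₁ : 1 ≤ (strongSet n σ β).card)
    (hs : (supp β).card = (strongSet n σ β).card + (weakSet n σ β).card)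
    (hκm : condNumber n σ β * minStrength n σ β ≤ C₀)
    (hX : RIP X ((supp β).card + 1) δ)
    (hδ : δ ≤ 1 / (72 * (1 + C₀)) /
      (condNumber n σ β * √((supp β).card : ℝ) * Real.log (p / α)))
    (hα : 0 < α) (hαp : α ≤ 1 / (72 * (1 + C₀)) / p) (hη : 0 < η)
    (hη' : η ≤ 1 / (72 * (1 + C₀)) / (condNumber n σ β * Real.log (p / α)))
    (ht : 13 * Real.log (p / α) / (η * minStrength n σ β) ≤ t)
    (ht' : t * (η * tauRate n p σ α δ) ≤ 1 / 100)
    (hν : ∀ j, |noiseCorr X w j| ≤ 4 * (σ * √(Real.log p / n)))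
    (hN : ∑ j ∈ strongSet n σ β, noiseCorr X w j ^ 2 ≤
      32 * (σ ^ 2 * ((M * (strongSet n σ β).card + (weakSet n σ β).card * Real.log p) / n))) :
    sqNorm (gdIter X (X *ᵥ β + w) η α t ^ 2 - β) ≤ 500 *
      epsilonRate n p σ α M (strongSet n σ β).card (weakSet n σ β).card := by
  have hne : (strongSet n σ β).Nonempty := Finset.card_pos.1 hs₁
  obtain ⟨j₀, hj₀⟩ := hne
  have hp1 : 1 ≤ p := Fin.pos j₀
  have hp1' : (1 : ℝ) ≤ p := by exact_mod_cast hp1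
  have hm := minStrength_pos ⟨j₀, hj₀⟩
  have hκ := one_le_condNumber ⟨j₀, hj₀⟩
  set S := strongSet n σ β with hSdef
  set m := minStrength n σ β
  set κ := condNumber n σ β
  set c := 1 / (72 * (1 + C₀)) with hc
  set lam := σ * √(Real.log p / n) with hlam
  have hc0 : 0 < c := by positivity
  have hc1 : c ≤ 1 / 72 := by rw [hc]; gcongr; linarith
  have hcC : c * C₀ ≤ 1 / 72 := by
    rw [hc, div_mul_eq_mul_div, div_le_div_iff₀ (by positivity) (by norm_num)]; linarith
  have hpα : p * α ≤ c := by rwa [le_div_iff₀' (by linarith)] at hαp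
  have hL : 1 ≤ Real.log (p / α) := by
    rw [Real.le_log_iff_exp_le (by positivity), le_div_iff₀ hα]
    have h1 := Real.exp_one_lt_d9
    have h2 : α ≤ 1 / 72 := by nlinarith
    nlinarith
  have hcard1 : 1 ≤ (supp β).card := by omega
  have hk1 : (1 : ℝ) ≤ (supp β).card := by exact_mod_cast hcard1
  have hδ0 : 0 ≤ δ := hX.nonneg (by omega) j₀
  have hlam0 : 0 ≤ lam := by positivity
  have hlogp : 0 ≤ Real.log p := Real.log_nonneg hp1'
  have hlam2 : lam ^ 2 = σ ^ 2 * (Real.log p / n) := by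
    rw [hlam, mul_pow, Real.sq_sqrt (by positivity)]
  have hweak : ∀ j ∉ S, β j ≤ 2 * lam := fun j hj => by
    by_cases h0 : j ∈ supp β
    · have := mem_weakSet_of_notMem_strongSet hσ hs h0 hj
      have := (Finset.mem_filter.1 this).2
      rw [abs_of_nonneg (hβ j)] at this
      rw [hlam]; linarith
    · rw [mem_supp, not_not] at h0
      rw [h0]; positivity
  have hW : ∑ j ∈ Sᶜ, β j ^ 2 ≤ (weakSet n σ β).card * (4 * lam ^ 2) := by
    have h1 : ∑ j ∈ Sᶜ, β j ^ 2 = ∑ j ∈ supp β \ S, β j ^ 2 := by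
      symm
      refine Finset.sum_subset (fun j hj => ?_) fun j hj hj' => ?_
      · exact Finset.mem_compl.2 (Finset.mem_sdiff.1 hj).2
      · rw [Finset.mem_sdiff, not_and_not_right, mem_supp] at hj'
        have : β j = 0 := by
          by_contra h
          exact (Finset.mem_compl.1 hj) (hj' h)
        simp [this]
    have h2 : (supp β \ S).card = (weakSet n σ β).card := by
      rw [Finset.card_sdiff_of_subset strongSet_subset, hs, Nat.add_sub_cancel_left]
    rw [h1, ← h2, ← nsmul_eq_mul]
    refine Finset.sum_le_card_nsmul _ _ _ fun j hj => ?_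
    have := hweak j (Finset.mem_sdiff.1 hj).2
    nlinarith [hβ j]
  have hreg : Regime S β (noiseCorr X w) (fun t => gdIter X (X *ᵥ β + w) η α t ^ 2)
      (fun t j => gramDev X (gdIter X (X *ᵥ β + w) η α t ^ 2 - β) j - noiseCorr X w j)
      c C₀ η α δ m κ (supp β).card lam (tauRate n p σ α δ) √(∑ j ∈ Sᶜ, β j ^ 2) t :=
    { c_pos := hc0
      c_le := hc1
      C_pos := hC₀
      cC_le := hcC
      η_pos := hη
      α_pos := hα
      δ_nonneg := hδ0
      m_pos := hm
      one_le_κ := hκ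
      one_le_L := hL
      κm_le := hκm
      one_le_k := hk1
      card_le := by exact_mod_cast Finset.card_le_card strongSet_subset
      k_le := by exact_mod_cast (Finset.card_le_univ _).trans_eq (Fintype.card_fin p)
      δ_le := by
        have := Real.sqrt_pos.2 (lt_of_lt_of_le one_pos hk1)
        exact (le_div_iff₀ (by positivity)).1 hδ
      η_le := (le_div_iff₀ (by positivity)).1 hη'
      α_le := hpα
      δα_le := le_max_left _ _
      lam_nonneg := hlam0
      lam_le := le_max_right _ _
      horizon_le := ht'
      le_horizon := ht
      β_nonneg := hβ
      le_β := fun j hj => by simpa [abs_of_nonneg (hβ j)] using minStrength_le hj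
      β_le := fun j => by
        simpa [abs_of_nonneg (hβ j)] using abs_le_condNumber_mul ⟨j₀, hj₀⟩ j
      β_weak := hweak
      W_nonneg := Real.sqrt_nonneg _
      W_le := by
        refine Real.sqrt_le_iff.2 ⟨by positivity, hW.trans ?_⟩
        rw [mul_pow (2 * _) lam, mul_pow 2 √_, Real.sq_sqrt (by linarith)]
        have : ((weakSet n σ β).card : ℝ) ≤ (supp β).card := by
          exact_mod_cast Finset.card_le_card weakSet_subset
        nlinarith [sq_nonneg lam]
      sum_β_le := by rw [Real.sq_sqrt (by positivity)]
      ν_le := hν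
      v_zero := fun j => by simp [gdIter]
      v_succ := fun t j => gdIter_succ_sq β w η α t j
      b_le := fun t j => by
        refine (abs_sub _ _).trans ?_
        rw [add_comm]
        refine add_le_add_right (hX.abs_gramDev_sub_le strongSet_subset le_rfl (by omega)
          (fun i => ?_) j) _
        rw [Pi.pow_apply]; positivity }
  have hfin := hreg.sum_sq_le
  rw [Real.sq_sqrt (by positivity)] at hfin
  have he1 : α ^ 2 ≤ epsilonRate n p σ α M S.card (weakSet n σ β).card := le_max_left _ _
  have he2 : σ ^ 2 * (M * S.card / n) ≤ epsilonRate n p σ α M S.card (weakSet n σ β).card :=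
    (le_max_left _ _).trans (le_max_right _ _)
  have he3 : σ ^ 2 * ((weakSet n σ β).card * Real.log p / n) ≤
      epsilonRate n p σ α M S.card (weakSet n σ β).card :=
    (le_max_right _ _).trans (le_max_right _ _)
  have e1 : σ ^ 2 * ((M * S.card + (weakSet n σ β).card * Real.log p) / n) =
    σ ^ 2 * (M * S.card / n) + σ ^ 2 * ((weakSet n σ β).card * Real.log p / n) := by ring
  have e2 : ((weakSet n σ β).card : ℝ) * (4 * lam ^ 2) =
    4 * (σ ^ 2 * ((weakSet n σ β).card * Real.log p / n)) := by rw [hlam2]; ring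
  rw [e1] at hN
  rw [e2] at hW
  have h0 : 0 ≤ α ^ 2 := sq_nonneg α
  -- The constants add up to `6 * 32 * 2 + 5 * 4 + 7 = 411 ≤ 500`.
  refine hfin.trans ?_
  linarith

end HadamardGD

/-! ### Gaussian exponential moments of the noise correlations. -/

namespace HadamardGD

/-- The law `N(0, I)` on `ℝⁿ`. -/
noncomputable def stdNoise (n : ℕ) : Measure (Fin n → ℝ) := Measure.pi fun _ => gaussianReal 0 1

instance (n : ℕ) : IsProbabilityMeasure (stdNoise n) := by unfold stdNoise; infer_instance

theorem gaussianNoise_eq_map (n : ℕ) (σ : ℝ) :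
    gaussianNoise n σ = (stdNoise n).map fun g => σ • g := by
  have h : gaussianReal 0 (σ ^ 2).toNNReal = (gaussianReal 0 1).map (σ * ·) := by
    rw [gaussianReal_map_const_mul, mul_zero, mul_one]
    congr 1
    exact NNReal.eq (Real.coe_toNNReal _ (sq_nonneg σ))
  rw [gaussianNoise, stdNoise, h]
  exact (Measure.pi_map_pi fun _ => (measurable_const_mul σ).aemeasurable).symm

theorem measure_ge_le_of_lintegral_exp_le {Ω : Type*} [MeasurableSpace Ω] {μ : Measure Ω}
    {Q : Ω → ℝ} (hQ : Measurable Q) {A : ℝ}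
    (h : ∫⁻ x, ENNReal.ofReal (Real.exp (Q x)) ∂μ ≤ ENNReal.ofReal (Real.exp A)) (r : ℝ) :
    μ {x | r ≤ Q x} ≤ ENNReal.ofReal (Real.exp (A - r)) := by
  have h1 := (mul_meas_ge_le_lintegral₀ (μ := μ)
    (f := fun x => ENNReal.ofReal (Real.exp (Q x))) (by fun_prop)
    (ENNReal.ofReal (Real.exp r))).trans h
  have e : {x | ENNReal.ofReal (Real.exp r) ≤ ENNReal.ofReal (Real.exp (Q x))} =
      {x | r ≤ Q x} := by
    ext x
    simp [ENNReal.ofReal_le_ofReal_iff (Real.exp_pos _).le]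
  rw [e] at h1
  rw [Real.exp_sub, ENNReal.ofReal_div_of_pos (Real.exp_pos r), ENNReal.le_div_iff_mul_le
    (Or.inl (by simp [Real.exp_pos])) (Or.inl ENNReal.ofReal_ne_top), mul_comm]
  exact h1

theorem lintegral_exp_dotProduct {n : ℕ} (a : Fin n → ℝ) :
    ∫⁻ g, ENNReal.ofReal (Real.exp (a ⬝ᵥ g)) ∂stdNoise n =
      ENNReal.ofReal (Real.exp (sqNorm a / 2)) := by
  have e : ∀ g : Fin n → ℝ, Real.exp (a ⬝ᵥ g) = ∏ i, Real.exp (a i * g i) := fun g => by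
    rw [dotProduct, Real.exp_sum]
  simp only [e]
  rw [stdNoise, ← ofReal_integral_eq_lintegral_ofReal]
  · rw [integral_fintype_prod_eq_prod (fun i x => Real.exp (a i * x))]
    congr 1
    have h1 : ∀ i, ∫ x, Real.exp (a i * x) ∂gaussianReal 0 1 = Real.exp (a i ^ 2 / 2) := by
      intro i
      have := congrFun (mgf_id_gaussianReal (μ := 0) (v := 1)) (a i)
      simpa [mgf] using this
    simp only [h1]
    rw [← Real.exp_sum, sqNorm, Finset.sum_div]
  · exact Integrable.fintype_prod (f := fun i x => Real.exp (a i * x))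
      fun i => integrable_exp_mul_gaussianReal (a i)
  · exact Filter.Eventually.of_forall fun g => Finset.prod_nonneg fun i _ => (Real.exp_pos _).le

theorem lintegral_exp_sq_div_four :
    ∫⁻ x, ENNReal.ofReal (Real.exp (x ^ 2 / 4)) ∂gaussianReal 0 1 = ENNReal.ofReal √2 := by
  rw [gaussianReal_of_var_ne_zero 0 one_ne_zero,
    lintegral_withDensity_eq_lintegral_mul _ (measurable_gaussianPDF 0 1) (by fun_prop)]
  have e : ∀ x : ℝ, (gaussianPDF 0 1 * fun x => ENNReal.ofReal (Real.exp (x ^ 2 / 4))) x =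
      ENNReal.ofReal ((√(2 * Real.pi))⁻¹ * Real.exp (-(1 / 4) * x ^ 2)) := by
    intro x
    rw [Pi.mul_apply, gaussianPDF, ← ENNReal.ofReal_mul (gaussianPDFReal_nonneg _ _ _),
      gaussianPDFReal, mul_assoc, ← Real.exp_add]
    congr 3
    · simp
    · simp; ring
  simp only [e]
  rw [← ofReal_integral_eq_lintegral_ofReal]
  · rw [integral_const_mul, integral_gaussian, ← Real.sqrt_inv, ← Real.sqrt_mul (by positivity)]
    congr 2
    have := Real.pi_pos
    field_simp; norm_num
  · exact (integrable_exp_neg_mul_sq (by norm_num)).const_mul _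
  · exact Filter.Eventually.of_forall fun x => by positivity

theorem lintegral_exp_sum_sq_le {p : ℕ} (S : Finset (Fin p)) :
    ∫⁻ h, ENNReal.ofReal (Real.exp ((∑ j ∈ S, h j ^ 2) / 4)) ∂stdNoise p ≤
      ENNReal.ofReal (Real.exp S.card) := by
  have hint : Integrable (fun x : ℝ => Real.exp (x ^ 2 / 4)) (gaussianReal 0 1) := by
    refine ⟨by fun_prop, ?_⟩
    rw [hasFiniteIntegral_iff_ofReal (Filter.Eventually.of_forall fun x => (Real.exp_pos _).le),
      lintegral_exp_sq_div_four]
    exact ENNReal.ofReal_lt_top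
  have hval : ∫ x, Real.exp (x ^ 2 / 4) ∂gaussianReal 0 1 = √2 := by
    rw [integral_eq_lintegral_of_nonneg_ae
      (Filter.Eventually.of_forall fun x => (Real.exp_pos _).le) hint.1,
      lintegral_exp_sq_div_four, ENNReal.toReal_ofReal (Real.sqrt_nonneg 2)]
  have e : ∀ h : Fin p → ℝ, Real.exp ((∑ j ∈ S, h j ^ 2) / 4) =
      ∏ j, (if j ∈ S then fun x : ℝ => Real.exp (x ^ 2 / 4) else fun _ => 1) (h j) := fun h => by
    rw [Finset.sum_div, Real.exp_sum, ← Finset.prod_filter_mul_prod_filter_not Finset.univ (· ∈ S),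
      Finset.prod_congr rfl (s₂ := Finset.univ.filter (· ∉ S)) (g := fun _ => (1 : ℝ))]
    · rw [Finset.prod_const_one, mul_one, Finset.filter_mem_eq_inter, Finset.univ_inter]
      exact Finset.prod_congr rfl fun j hj => by simp [hj]
    · intro j hj
      simp [(Finset.mem_filter.1 hj).2]
  simp only [e]
  rw [stdNoise, ← ofReal_integral_eq_lintegral_ofReal]
  · refine ENNReal.ofReal_le_ofReal ?_
    rw [integral_fintype_prod_eq_prod
      (fun j => if j ∈ S then fun x : ℝ => Real.exp (x ^ 2 / 4) else fun _ => 1)]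
    have h1 : ∀ j, ∫ x, (if j ∈ S then fun x : ℝ => Real.exp (x ^ 2 / 4) else fun _ => 1) x
        ∂gaussianReal 0 1 = if j ∈ S then √2 else 1 := by
      intro j
      split_ifs
      · exact hval
      · simp
    simp only [h1]
    rw [Finset.prod_ite_mem, Finset.univ_inter, Finset.prod_const, ← mul_one (S.card : ℝ),
      Real.exp_nat_mul]
    gcongr
    have : √2 ≤ 2 := Real.sqrt_le_iff.2 ⟨by norm_num, by norm_num⟩
    linarith [Real.add_one_le_exp 1]
  · refine Integrable.fintype_prod
      (f := fun j => if j ∈ S then fun x : ℝ => Real.exp (x ^ 2 / 4) else fun _ => 1) fun j => ?_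
    split_ifs
    · exact hint
    · exact integrable_const _
  · refine Filter.Eventually.of_forall fun g => Finset.prod_nonneg fun j _ => ?_
    split_ifs
    · exact (Real.exp_pos _).le
    · exact zero_le_one

variable {n p : ℕ} {X : Matrix (Fin n) (Fin p) ℝ}

theorem noiseCorr_eq_dotProduct (j : Fin p) (g : Fin n → ℝ) :
    noiseCorr X g j = ((1 / (n : ℝ)) • X *ᵥ Pi.single j 1) ⬝ᵥ g := by
  rw [smul_dotProduct, Matrix.mulVec_single_one]; rfl

theorem noiseCorr_smul (r : ℝ) (g : Fin n → ℝ) (j : Fin p) :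
    noiseCorr X (r • g) j = r * noiseCorr X g j := by
  rw [noiseCorr_eq_dotProduct, noiseCorr_eq_dotProduct, dotProduct_smul, smul_eq_mul]

theorem measurable_noiseCorr (j : Fin p) : Measurable fun g => noiseCorr X g j := by
  simp only [noiseCorr_eq_dotProduct, dotProduct]
  fun_prop

/-- Chernoff with parameter `2 n q`: the exponential moment is at most `exp (4 log p)` and the
threshold becomes `8 log p`. If `q = 0` the claimed bound is `1`. -/
theorem stdNoise_noiseCorr_ge_le (hn : 0 < n) {j : Fin p} {a : ℝ}
    (ha : |a| = 1) (hX : (1 / (n : ℝ)) * sqNorm (X *ᵥ Pi.single j 1) ≤ 2) :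
    stdNoise n {g | 4 * √(Real.log p / n) ≤ a * noiseCorr X g j} ≤
      ENNReal.ofReal (Real.exp (-4 * Real.log p)) := by
  have hn' : (0 : ℝ) < n := by exact_mod_cast hn
  set q := √(Real.log p / n) with hq
  have hq2 : n * q ^ 2 = Real.log p := by
    rw [hq, Real.sq_sqrt (by positivity)]; field_simp
  have ha2 : a ^ 2 = 1 := by rw [← sq_abs, ha, one_pow]
  rcases (Real.sqrt_nonneg (Real.log p / n)).eq_or_lt with h0 | h0
  · have hl : Real.log p = 0 := by rw [← hq2, hq, ← h0]; simp
    rw [hl]; simpa using prob_le_one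
  · have e : ∀ g, 2 * n * q * a * noiseCorr X g j =
        ((2 * q * a) • X *ᵥ Pi.single j 1) ⬝ᵥ g := fun g => by
      rw [noiseCorr_eq_dotProduct, smul_dotProduct, smul_dotProduct, smul_eq_mul, smul_eq_mul]
      field_simp
    have h1 : ∫⁻ g, ENNReal.ofReal (Real.exp (2 * n * q * a * noiseCorr X g j)) ∂stdNoise n ≤
        ENNReal.ofReal (Real.exp (4 * Real.log p)) := by
      simp only [e]
      rw [lintegral_exp_dotProduct, sqNorm_smul]
      refine ENNReal.ofReal_le_ofReal (Real.exp_le_exp.2 ?_)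
      have h2 : sqNorm (X *ᵥ Pi.single j 1) ≤ 2 * n := by
        rw [one_div, inv_mul_le_iff₀ hn'] at hX; linarith
      have : (2 * q * a) ^ 2 = 4 * q ^ 2 := by rw [mul_pow, ha2]; ring
      rw [this, ← hq2]
      nlinarith [sq_nonneg q]
    have h3 := measure_ge_le_of_lintegral_exp_le
      ((measurable_noiseCorr (X := X) j).const_mul (2 * n * q * a)) h1 (8 * Real.log p)
    refine (measure_mono fun g hg => ?_).trans (h3.trans (le_of_eq ?_))
    · simp only [Set.mem_ofPred_eq] at hg ⊢
      have h4 : 0 ≤ 2 * n * q := by positivity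
      have := mul_le_mul_of_nonneg_left hg h4
      rw [← hq2]; linarith
    · congr 2; ring

/-- Decoupling: `exp (‖a‖² / 2)` is the mean of `exp (a ⬝ᵥ h)` over an independent standard Gaussian
`h`. After exchanging the integrals, `g` is integrated first, so only `X` on vectors supported in
`S` has to be bounded, and what remains is a chi-square moment of `h`. -/
theorem lintegral_exp_noiseCorr_le (hn : 0 < n) (S : Finset (Fin p))
    (hX : ∀ h : Fin p → ℝ, supp h ⊆ S → (1 / (n : ℝ)) * sqNorm (X *ᵥ h) ≤ 2 * sqNorm h) :
    ∫⁻ g, ENNReal.ofReal (Real.exp (n / 8 * ∑ j ∈ S, noiseCorr X g j ^ 2)) ∂stdNoise n ≤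
      ENNReal.ofReal (Real.exp S.card) := by
  have hn' : (0 : ℝ) < n := by exact_mod_cast hn
  have hsq : √(n : ℝ) ^ 2 = n := Real.sq_sqrt hn'.le
  let P : (Fin p → ℝ) → Fin p → ℝ := fun h j => if j ∈ S then h j else 0
  have hP : ∀ h, sqNorm (P h) = ∑ j ∈ S, h j ^ 2 := fun h => by
    simp [sqNorm, P, ite_pow, Finset.sum_ite_mem]
  have hPs : ∀ h, supp (P h) ⊆ S := fun h j hj => by
    by_contra hjS
    exact (mem_supp.1 hj) (by simp [P, hjS])
  let a : (Fin n → ℝ) → Fin p → ℝ := fun g => (√n / 2) • P (noiseCorr X g)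
  let b : (Fin p → ℝ) → Fin n → ℝ := fun h => (√n / 2 * (1 / n)) • X *ᵥ P h
  have hab : ∀ g h, a g ⬝ᵥ h = b h ⬝ᵥ g := fun g h => by
    have h1 : P (noiseCorr X g) ⬝ᵥ h = noiseCorr X g ⬝ᵥ P h := by
      simp only [dotProduct, P, ite_mul, mul_ite, zero_mul, mul_zero]
    simp only [a, b, smul_dotProduct, smul_eq_mul]
    rw [h1]
    simp only [noiseCorr, smul_dotProduct, smul_eq_mul]
    rw [Matrix.mulVec_transpose, ← Matrix.dotProduct_mulVec, dotProduct_comm g]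
    ring
  have ha : ∀ g, sqNorm (a g) / 2 = n / 8 * ∑ j ∈ S, noiseCorr X g j ^ 2 := fun g => by
    rw [sqNorm_smul, hP, div_pow, hsq]; ring
  have hb : ∀ h, sqNorm (b h) / 2 ≤ (∑ j ∈ S, h j ^ 2) / 4 := fun h => by
    have h1 := hX _ (hPs h)
    rw [hP] at h1
    have h2 : sqNorm (b h) / 2 = 1 / 8 * (1 / n * sqNorm (X *ᵥ P h)) := by
      rw [sqNorm_smul, mul_pow, div_pow, hsq]
      field_simp; ring
    rw [h2]; linarith
  have hmP : ∀ j, Measurable fun g => P (noiseCorr X g) j := fun j => by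
    simp only [P]
    split_ifs
    · exact measurable_noiseCorr j
    · exact measurable_const
  have hmeas : Measurable fun x : (Fin n → ℝ) × (Fin p → ℝ) => a x.1 ⬝ᵥ x.2 := by
    simp only [a, dotProduct, Pi.smul_apply, smul_eq_mul]
    refine Finset.measurable_sum _ fun j _ => ?_
    exact ((((hmP j).comp measurable_fst).const_mul _)).mul
      ((measurable_pi_apply j).comp measurable_snd)
  calc _ = ∫⁻ g, ∫⁻ h, ENNReal.ofReal (Real.exp (a g ⬝ᵥ h)) ∂stdNoise p ∂stdNoise n := by
        simp only [lintegral_exp_dotProduct, ha]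
    _ = ∫⁻ h, ∫⁻ g, ENNReal.ofReal (Real.exp (a g ⬝ᵥ h)) ∂stdNoise n ∂stdNoise p :=
        lintegral_lintegral_swap
          (hmeas.exp.ennreal_ofReal.aemeasurable)
    _ ≤ ∫⁻ h, ENNReal.ofReal (Real.exp ((∑ j ∈ S, h j ^ 2) / 4)) ∂stdNoise p := by
        refine lintegral_mono fun h => ?_
        simp only [hab, lintegral_exp_dotProduct]
        exact ENNReal.ofReal_le_ofReal (Real.exp_le_exp.2 (hb h))
    _ ≤ _ := lintegral_exp_sum_sq_le S

end HadamardGD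

/-! ### Probability of the good noise event. -/

namespace HadamardGD

variable {n p : ℕ} {X : Matrix (Fin n) (Fin p) ℝ}

/-- The noise vectors of level `σ` whose correlations with the columns of `X` are uniformly small,
and small in mean square on `S`. -/
def goodNoise (X : Matrix (Fin n) (Fin p) ℝ) (S : Finset (Fin p)) (σ B : ℝ) :
    Set (Fin n → ℝ) :=
  {w | (∀ j, |noiseCorr X w j| ≤ 4 * (σ * √(Real.log p / n))) ∧
    ∑ j ∈ S, noiseCorr X w j ^ 2 ≤ 32 * (σ ^ 2 * (B / n))}

theorem measurableSet_goodNoise (S : Finset (Fin p)) (σ B : ℝ) :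
    MeasurableSet (goodNoise X S σ B) := by
  have h := fun j => measurable_noiseCorr (X := X) j
  have e : goodNoise X S σ B =
      (⋂ j, {w | |noiseCorr X w j| ≤ 4 * (σ * √(Real.log p / n))}) ∩
        {w | ∑ j ∈ S, noiseCorr X w j ^ 2 ≤ 32 * (σ ^ 2 * (B / n))} := by
    ext w; simp [goodNoise]
  rw [e]
  refine MeasurableSet.inter ?_ ?_
  · exact MeasurableSet.iInter fun j => measurableSet_le (h j).abs measurable_const
  · exact measurableSet_le (Finset.measurable_sum _ fun j _ => (h j).pow_const 2)
      measurable_const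

theorem stdNoise_compl_goodNoise_le (hn : 0 < n) (hp : 0 < p) (S : Finset (Fin p)) (B : ℝ)
    (hX : ∀ h : Fin p → ℝ, supp h ⊆ S → (1 / (n : ℝ)) * sqNorm (X *ᵥ h) ≤ 2 * sqNorm h)
    (hX1 : ∀ j, (1 / (n : ℝ)) * sqNorm (X *ᵥ Pi.single j 1) ≤ 2) :
    (stdNoise n).real (goodNoise X S 1 B)ᶜ ≤
      p * (2 * Real.exp (-4 * Real.log p)) + Real.exp (S.card - 4 * B) := by
  have hn' : (0 : ℝ) < n := by exact_mod_cast hn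
  have hlog : 0 ≤ Real.log p := Real.log_nonneg (by exact_mod_cast hp)
  set q := √(Real.log p / n) with hq
  have hsub : (goodNoise X S 1 B)ᶜ ⊆
      (⋃ j, ({g | 4 * q ≤ 1 * noiseCorr X g j} ∪ {g | 4 * q ≤ -1 * noiseCorr X g j})) ∪
        {g | 4 * B ≤ n / 8 * ∑ j ∈ S, noiseCorr X g j ^ 2} := by
    intro g hg
    by_contra hcon
    simp only [Set.mem_union, Set.mem_iUnion, Set.mem_ofPred_eq, not_or, not_exists, not_le]
      at hcon
    refine hg ⟨fun j => ?_, ?_⟩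
    · rw [abs_le]
      constructor <;> linarith [(hcon.1 j).1, (hcon.1 j).2]
    · have h1 : 32 * (1 ^ 2 * (B / n)) = 8 / n * (4 * B) := by ring
      have h2 : ∑ j ∈ S, noiseCorr X g j ^ 2 =
        8 / n * (n / 8 * ∑ j ∈ S, noiseCorr X g j ^ 2) := by field_simp
      rw [h1, h2]
      have := hcon.2.le
      gcongr
  refine (measureReal_mono hsub).trans ((measureReal_union_le _ _).trans (add_le_add ?_ ?_))
  · refine (measureReal_iUnion_fintype_le _).trans ?_
    have h1 : ∀ j : Fin p, ∀ a : ℝ, |a| = 1 →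
        (stdNoise n).real {g | 4 * q ≤ a * noiseCorr X g j} ≤ Real.exp (-4 * Real.log p) :=
      fun j a ha => ENNReal.toReal_le_of_le_ofReal (Real.exp_pos _).le
        (stdNoise_noiseCorr_ge_le hn ha (hX1 j))
    calc _ ≤ ∑ j : Fin p, 2 * Real.exp (-4 * Real.log p) := by
          refine Finset.sum_le_sum fun j _ => (measureReal_union_le _ _).trans ?_
          linarith [h1 j 1 (by simp), h1 j (-1) (by simp)]
      _ = _ := by simp
  · have hm : Measurable fun g => (n : ℝ) / 8 * ∑ j ∈ S, noiseCorr X g j ^ 2 :=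
      (Finset.measurable_sum _ fun j _ =>
        (measurable_noiseCorr (X := X) j).pow_const 2).const_mul _
    exact ENNReal.toReal_le_of_le_ofReal (Real.exp_pos _).le
      (measure_ge_le_of_lintegral_exp_le hm (lintegral_exp_noiseCorr_le hn S hX) (4 * B))

theorem le_gaussianNoise_goodNoise (hn : 0 < n) (hp : 0 < p) (S : Finset (Fin p)) {σ : ℝ}
    (hσ : 0 ≤ σ) (B : ℝ)
    (hX : ∀ h : Fin p → ℝ, supp h ⊆ S → (1 / (n : ℝ)) * sqNorm (X *ᵥ h) ≤ 2 * sqNorm h)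
    (hX1 : ∀ j, (1 / (n : ℝ)) * sqNorm (X *ᵥ Pi.single j 1) ≤ 2) :
    1 - (p * (2 * Real.exp (-4 * Real.log p)) + Real.exp (S.card - 4 * B)) ≤
      (gaussianNoise n σ).real (goodNoise X S σ B) := by
  rw [gaussianNoise_eq_map, map_measureReal_apply (by fun_prop) (measurableSet_goodNoise S σ B)]
  have h1 := stdNoise_compl_goodNoise_le hn hp S B hX hX1
  rw [probReal_compl_eq_one_sub (measurableSet_goodNoise S 1 B)] at h1
  have h2 : goodNoise X S 1 B ⊆ (fun g => σ • g) ⁻¹' goodNoise X S σ B := by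
    rintro g ⟨hg1, hg2⟩
    refine ⟨fun j => ?_, ?_⟩
    · rw [noiseCorr_smul, abs_mul, abs_of_nonneg hσ]
      have := mul_le_mul_of_nonneg_left (hg1 j) hσ
      linarith
    · simp only [noiseCorr_smul, mul_pow, ← Finset.mul_sum]
      have := mul_le_mul_of_nonneg_left hg2 (sq_nonneg σ)
      linarith
  linarith [measureReal_mono (μ := stdNoise n) h2]

/-- With no weak signal the second exponential is at most `exp (-M s₁)`. Otherwise `M s₂` need not
be controlled by `s₂ log p`, but the term is at most `p ^ (-4)` and is absorbed, with the union
bound, into `1 / p`. -/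
theorem failure_le {s₁ s₂ : ℕ} {M : ℝ} (hp : 2 ≤ p) (hM : 1 ≤ M) :
    (p : ℝ) * (2 * Real.exp (-4 * Real.log p)) +
        Real.exp (s₁ - 4 * (M * s₁ + s₂ * Real.log p)) ≤
      (p : ℝ) ^ (-1 : ℝ) + Real.exp (-1 * M * ((s₁ + s₂ : ℕ) : ℝ)) := by
  have hp' : (2 : ℝ) ≤ p := by exact_mod_cast hp
  have hlog : 0 ≤ Real.log p := Real.log_nonneg (by linarith)
  have e4 : Real.exp (-4 * Real.log p) = 1 / (p : ℝ) ^ 4 := by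
    rw [neg_mul, Real.exp_neg, show (4 : ℝ) = (4 : ℕ) by norm_num, Real.exp_nat_mul,
      Real.exp_log (by linarith), one_div]
  have hs : (s₁ : ℝ) ≤ M * s₁ := le_mul_of_one_le_left (by positivity) hM
  rw [Real.rpow_neg_one, e4]
  rcases Nat.eq_zero_or_pos s₂ with h | h
  · subst h
    refine add_le_add ?_ (Real.exp_le_exp.2 ?_)
    · rw [show (p : ℝ) * (2 * (1 / (p : ℝ) ^ 4)) = 2 / (p : ℝ) ^ 2 * (p : ℝ)⁻¹ by field_simp]
      refine mul_le_of_le_one_left (by positivity) ?_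
      rw [div_le_one (by positivity)]
      nlinarith
    · push_cast
      have : (0 : ℝ) ≤ s₁ := by positivity
      linarith
  · have h1 : Real.exp (s₁ - 4 * (M * s₁ + s₂ * Real.log p)) ≤ 1 / (p : ℝ) ^ 4 := by
      rw [← e4, Real.exp_le_exp]
      have h2 : (1 : ℝ) ≤ s₂ := by exact_mod_cast h
      have : (0 : ℝ) ≤ s₁ := by positivity
      nlinarith
    have h3 : (p : ℝ) * (2 * (1 / (p : ℝ) ^ 4)) + 1 / (p : ℝ) ^ 4 ≤ (p : ℝ)⁻¹ := by
      rw [show (p : ℝ) * (2 * (1 / (p : ℝ) ^ 4)) + 1 / (p : ℝ) ^ 4 =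
        (2 * p + 1) / (p : ℝ) ^ 3 * (p : ℝ)⁻¹ by field_simp]
      refine mul_le_of_le_one_left (by positivity) ?_
      rw [div_le_one (by positivity)]
      have : 4 * (p : ℝ) ≤ p ^ 3 := by nlinarith [mul_self_nonneg ((p : ℝ) - 2)]
      linarith
    linarith [Real.exp_pos (-1 * M * ((s₁ + s₂ : ℕ) : ℝ))]

end HadamardGD

/-! ### Choice of constants and transfer to the law of `w`. -/

theorem mainTheorem1 (C₀ : ℝ) (hC₀ : 0 < C₀) :
    ∃ c₁ c₂ c₃ c₄ c₅ c₆ : ℝ,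
      0 < c₁ ∧ 0 < c₂ ∧ 0 < c₃ ∧ 0 < c₄ ∧ 0 < c₅ ∧ 0 < c₆ ∧
      ∀ (n p : ℕ) (X : Matrix (Fin n) (Fin p) ℝ) (β : Fin p → ℝ) (σ α η δ M : ℝ)
        (Ω : Type*) [MeasurableSpace Ω] (P : Measure Ω) [IsProbabilityMeasure P]
        (w : Ω → Fin n → ℝ) (s s₁ s₂ : ℕ) (m κ : ℝ),
        0 < n → 0 ≤ σ → 1 ≤ M →
        HasLaw w (HadamardGD.gaussianNoise n σ) P →
        s = (HadamardGD.supp β).card →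
        s₁ = (HadamardGD.strongSet n σ β).card →
        s₂ = (HadamardGD.weakSet n σ β).card →
        m = HadamardGD.minStrength n σ β →
        κ = HadamardGD.condNumber n σ β →
        -- the signal is non-negative, there is a strong signal, and each nonzero signal is strong or weak
        (∀ j, 0 ≤ β j) → 1 ≤ s₁ → s = s₁ + s₂ → κ * m ≤ C₀ →
        -- the design matrix
        HadamardGD.RIP X (s + 1) δ → δ ≤ c₃ / (κ * √s * Real.log (p / α)) →
        -- the initialization and the step size
        0 < α → α ≤ c₃ / p → 0 < η → η ≤ c₃ / (κ * Real.log (p / α)) →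
        -- the window for `t`; the right end `c₂ / (η τ)` is infinite when `τ = 0`
        ∀ t : ℕ, c₁ * Real.log (p / α) / (η * m) ≤ t →
          t * (η * HadamardGD.tauRate n p σ α δ) ≤ c₂ →
          1 - (p : ℝ) ^ (-c₄) - Real.exp (-c₅ * M * s) ≤
            P.real {ω | HadamardGD.sqNorm
                (HadamardGD.gdIter X (X *ᵥ β + w ω) η α t ^ 2 - β) ≤
              c₆ * HadamardGD.epsilonRate n p σ α M s₁ s₂} := by
  refine ⟨13, 1 / 100, 1 / (72 * (1 + C₀)), 1, 1, 500, by norm_num, by norm_num, by positivity,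
    one_pos, one_pos, by norm_num, ?_⟩
  rintro n p X β σ α η δ M Ω _ P _ w s s₁ s₂ m κ hn hσ hM hw rfl rfl rfl rfl rfl hβ hs₁ hs hκm
    hX hδ hα hαp hη hη' t ht ht'
  have hne : (HadamardGD.strongSet n σ β).Nonempty := Finset.card_pos.1 hs₁
  obtain ⟨j₀, hj₀⟩ := hne
  have hp : 0 < p := Fin.pos j₀
  have hcard : 1 ≤ (HadamardGD.supp β).card := by omega
  -- For `p = 1` the claimed probability is not positive.
  rcases (Nat.succ_le_of_lt hp).eq_or_lt with hp1 | hp2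
  · have h1 : (p : ℝ) ^ (-1 : ℝ) = 1 := by simp [← hp1]
    rw [h1]
    linarith [Real.exp_pos (-1 * M * ((HadamardGD.supp β).card : ℝ)), measureReal_nonneg (μ := P)
      (s := {ω | HadamardGD.sqNorm (HadamardGD.gdIter X (X *ᵥ β + w ω) η α t ^ 2 - β) ≤
        500 * HadamardGD.epsilonRate n p σ α M (HadamardGD.strongSet n σ β).card
          (HadamardGD.weakSet n σ β).card})]
  -- This turns the upper RIP factor `1 + δ` into the `2` required by the Gaussian bounds.
  have hδ1 : δ ≤ 1 := by
    have hκ := HadamardGD.one_le_condNumber ⟨j₀, hj₀⟩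
    have hp' : (2 : ℝ) ≤ p := by exact_mod_cast hp2
    have hc1 : 1 / (72 * (1 + C₀)) ≤ 1 / 72 := by gcongr; linarith
    have hL : 1 ≤ Real.log (p / α) := by
      rw [le_div_iff₀' (by linarith)] at hαp
      rw [Real.le_log_iff_exp_le (by positivity), le_div_iff₀ hα]
      nlinarith [Real.exp_one_lt_d9]
    have hk : 1 ≤ √((HadamardGD.supp β).card : ℝ) :=
      Real.one_le_sqrt.2 (by exact_mod_cast hcard)
    refine hδ.trans (div_le_one_of_le₀ ?_ (by positivity))
    have := one_le_mul_of_one_le_of_one_le (one_le_mul_of_one_le_of_one_le hκ hk) hL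
    linarith
  have hX1 : ∀ h : Fin p → ℝ, (HadamardGD.supp h).card ≤ (HadamardGD.supp β).card + 1 →
      (1 / (n : ℝ)) * HadamardGD.sqNorm (X *ᵥ h) ≤ 2 * HadamardGD.sqNorm h := fun h hh =>
    (hX h hh).2.trans
      (mul_le_mul_of_nonneg_right (by linarith) (HadamardGD.sqNorm_nonneg h))
  have hprob := HadamardGD.le_gaussianNoise_goodNoise (X := X) hn hp
    (HadamardGD.strongSet n σ β) hσ
    (M * (HadamardGD.strongSet n σ β).card + (HadamardGD.weakSet n σ β).card * Real.log p)
    (fun h hh => hX1 h (((Finset.card_le_card hh).trans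
      (Finset.card_le_card HadamardGD.strongSet_subset)).trans (Nat.le_succ _)))
    (fun j => by
      have := hX1 (Pi.single j 1) (by
        refine (Finset.card_le_card (t := {j}) fun i hi => ?_).trans (by simp)
        rw [Finset.mem_singleton]
        by_contra hij
        exact (HadamardGD.mem_supp.1 hi) (by simp [hij]))
      simpa [HadamardGD.sqNorm_single] using this)
  have hfail := HadamardGD.failure_le (s₁ := (HadamardGD.strongSet n σ β).card)
    (s₂ := (HadamardGD.weakSet n σ β).card) hp2 hM
  rw [← hs] at hfail
  rw [← hw.map_eq, map_measureReal_apply_of_aemeasurable hw.aemeasurable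
    (HadamardGD.measurableSet_goodNoise _ _ _)] at hprob
  refine le_trans (by linarith) (hprob.trans (measureReal_mono fun ω hω => ?_))
  exact HadamardGD.sqNorm_gdIter_sub_le hC₀ hσ hβ hs₁ hs hκm hX hδ hα hαp hη hη' ht ht'
    hω.1 hω.2
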